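/- Fix an integer $k\ge 2$ and let $(T_{i,v})_{i\ge 1,\,v\ge 1}$ be i.i.d. exponential random variables with mean $1$. Let $G_{r,v}=\sum_{i=1}^{r}T_{i,v}$. Consider the path with nodes $1,\dots,n$ rooted at $1$. Node $v$ is called a one-record if $G_{1,v}<G_{k,u}$ for every $u$ with $1\le u<v$ (so node $1$ is always a one-record). Let $\mathcal X_{n,1}$ be the number of one-records among the nodes $1,\dots,n$. Then, as $n\to\infty$, $$ \mathbb E[\mathcal X_{n,1}(\mathcal X_{n,1}-1)]\sim \mathbb E[\mathcal X_{n,1}^2]\sim \gamma_k\, n^{2-\frac2k}, \qquad \gamma_k=\frac{\Gamma\left(\frac2k\right)(k!)^{\frac2k}}{k-1}+2\lambda_k, $$ where $$ \lambda_k=\frac{\pi\cot\left(\frac{\pi}{k}\right)\Gamma\left(\frac2k\right)(k!)^{\frac2k}}{2(k-2)(k-1)}\quad\text{for } k>2, \qquad \lambda_2=\frac{\pi^2}{4}. $$ Moreover, $$ \operatorname{Var}(\mathcal X_{n,1})\sim\left(\gamma_k-\eta_{k,1}^2\right)n^{2-\frac2k}, \qquad \eta_{k,1}=\frac{(k!)^{\frac1k}}{k-1}\,\Gamma\left(\frac1k\right),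 $$ and in particular, for $k=2$, $$ \operatorname{Var}(\mathcal X_{n,1})\sim\left(\frac{\pi^2}{2}+2-2\pi\right)n . $$ Here $a_n\sim b_n$ means $a_n/b_n\to1$. -/

import Mathlib

open MeasureTheory ProbabilityTheory

namespace KCut

noncomputable section

/-- `ringTime T r v ω` is the time `G_{r,v} = ∑_{i=1}^{r} T_{i,v}` at which the alarm clock of node
`v` rings for the `r`-th time. Holding times and nodes are numbered from `0`: `T i v` is the
`(i+1)`-st holding time of the `(v+1)`-st node of the path, counted from the root. -/
def ringTime {Ω : Type*} (T : ℕ → ℕ → Ω → ℝ) (r v : ℕ) (ω : Ω) : ℝ :=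
  ∑ i ∈ Finset.range r, T i v ω

/-- The event that node `v` of the path is an `r`-record: its clock rings for the `r`-th time
strictly before the clock of any ancestor `u < v` has rung `k` times.
The root (which has no ancestors) is always an `r`-record. -/
def recordEvent {Ω : Type*} (T : ℕ → ℕ → Ω → ℝ) (k r v : ℕ) : Set Ω :=
  {ω | ∀ u < v, ringTime T r v ω < ringTime T k u ω}

/-- The number `𝒳_{n,r}` of `r`-records in the path with `n` nodes. -/
def recordCount {Ω : Type*} (T : ℕ → ℕ → Ω → ℝ) (k n r : ℕ) (ω : Ω) : ℝ :=
  ∑ v ∈ Finset.range n, (recordEvent T k r v).indicator (fun _ => (1 : ℝ)) ω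

/-- The constant `η_{k,r} = (k!)^{r/k} / (k - r) * Γ(r/k) / Γ(r)`. -/
def eta (k r : ℕ) : ℝ :=
  (k.factorial : ℝ) ^ ((r : ℝ) / (k : ℝ)) / ((k : ℝ) - (r : ℝ)) *
    (Real.Gamma ((r : ℝ) / (k : ℝ)) / Real.Gamma (r : ℝ))

/-- The constant `λ_k`. -/
def lam (k : ℕ) : ℝ :=
  if k = 2 then Real.pi ^ 2 / 4
  else
    Real.pi * Real.cot (Real.pi / (k : ℝ)) * Real.Gamma (2 / (k : ℝ)) *
        (k.factorial : ℝ) ^ (2 / (k : ℝ)) /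
      (2 * ((k : ℝ) - 2) * ((k : ℝ) - 1))

/-- The constant `γ_k = Γ(2/k) (k!)^{2/k} / (k - 1) + 2 λ_k`. -/
def gam (k : ℕ) : ℝ :=
  Real.Gamma (2 / (k : ℝ)) * (k.factorial : ℝ) ^ (2 / (k : ℝ)) / ((k : ℝ) - 1) + 2 * lam k

end

end KCut


/-!
Given its first ringing time `x`, node `v` is a one-record when `v` independent Erlang variables
exceed `x`, so it is one with probability `erlangTail k x ^ v`. For two nodes `u < v` with first
ringing times `x` and `y`, the nodes before `u` have to exceed `max x y`, those between `u` and `v`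
only `y`, and `u` itself has to collect `k - 1` further rings in more than `y - x`. Summing over the
nodes writes the first and second factorial moments as integrals over `(0, ∞)` and `(0, ∞)²`.

Since `1 - erlangTail k x ~ x ^ k / k!` at `0`, the time scale is `n ^ (-1 / k)`. After rescaling
the geometric sums converge to integrals of exponentials, with an integrable bound uniform in `n`.
In the limiting double integral the region `x ≤ y` gives a Gamma integral. On the region `y < x` a
geometric expansion of `1 / (x ^ k - y ^ k)` gives the series `∑ j, 1 / ((k j + 1) (k j + k - 1))`,
which the partial fraction expansion of the cotangent evaluates for `k > 2` and `ζ(2)` for `k = 2`.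
-/

namespace KCut

open Set Filter Topology
open scoped ENNReal Pointwise

/-- The law of a sum of `r` independent standard exponential variables. -/
noncomputable def erlangMeasure : ℕ → Measure ℝ
  | 0 => Measure.dirac 0
  | r + 1 => expMeasure 1 ∗ erlangMeasure r

instance isProbabilityMeasure_expMeasure_one : IsProbabilityMeasure (expMeasure 1) :=
  isProbabilityMeasure_expMeasure one_pos

instance isProbabilityMeasure_erlangMeasure : ∀ r, IsProbabilityMeasure (erlangMeasure r)
  | 0 => Measure.dirac.isProbabilityMeasure
  | r + 1 => by
    have := isProbabilityMeasure_erlangMeasure r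
    unfold erlangMeasure
    infer_instance

lemma expMeasure_one_eq_withDensity :
    expMeasure 1 = (volume.restrict (Ioi (0 : ℝ))).withDensity
      (fun x => ENNReal.ofReal (Real.exp (-x))) := by
  change volume.withDensity (exponentialPDF 1) = _
  rw [restrict_Ioi_eq_restrict_Ici, ← withDensity_indicator measurableSet_Ici]
  congr 1
  ext x
  rw [exponentialPDF_eq, indicator_apply]
  by_cases hx : 0 ≤ x <;> simp [hx]

lemma integral_expMeasure_one (f : ℝ → ℝ) :
    ∫ x, f x ∂(expMeasure 1) = ∫ x in Ioi 0, Real.exp (-x) * f x := by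
  rw [expMeasure_one_eq_withDensity, integral_withDensity_eq_integral_toReal_smul (by fun_prop)
    (ae_of_all _ fun _ => ENNReal.ofReal_lt_top)]
  simp [ENNReal.toReal_ofReal (Real.exp_pos _).le]

lemma integral_expMeasure_one_prod (f : ℝ × ℝ → ℝ) :
    ∫ z, f z ∂((expMeasure 1).prod (expMeasure 1)) =
      ∫ z in Ioi (0 : ℝ) ×ˢ Ioi (0 : ℝ), Real.exp (-z.1) * Real.exp (-z.2) * f z := by
  rw [expMeasure_one_eq_withDensity, prod_withDensity (by fun_prop) (by fun_prop),
    Measure.prod_restrict, ← Measure.volume_eq_prod,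
    integral_withDensity_eq_integral_toReal_smul (by fun_prop)
      (ae_of_all _ fun _ => ENNReal.mul_lt_top ENNReal.ofReal_lt_top ENNReal.ofReal_lt_top)]
  simp [ENNReal.toReal_ofReal (Real.exp_pos _).le]

lemma measurable_measure_Iic_sub (μ : Measure ℝ) (x : ℝ) :
    Measurable fun t => μ (Iic (x - t)) :=
  Antitone.measurable fun _ _ h => measure_mono (Iic_subset_Iic.2 (by linarith))

lemma erlangMeasure_succ_Iic (r : ℕ) (x : ℝ) :
    erlangMeasure (r + 1) (Iic x) =
      ∫⁻ t in Ioi 0, ENNReal.ofReal (Real.exp (-t)) * erlangMeasure r (Iic (x - t)) := by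
  calc erlangMeasure (r + 1) (Iic x)
      = ∫⁻ t, erlangMeasure r (Iic (x - t)) ∂(expMeasure 1) := by
        rw [erlangMeasure, ← lintegral_indicator_one measurableSet_Iic,
          Measure.lintegral_conv (measurable_one.indicator measurableSet_Iic)]
        refine lintegral_congr fun t => ?_
        rw [← lintegral_indicator_one measurableSet_Iic]
        simp only [indicator, mem_Iic, le_sub_iff_add_le', Pi.one_apply]
    _ = _ := by
        rw [expMeasure_one_eq_withDensity, lintegral_withDensity_eq_lintegral_mul _
          (by fun_prop) (measurable_measure_Iic_sub _ _)]
        rfl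

lemma erlangMeasure_Iic_of_neg (r : ℕ) {x : ℝ} (hx : x < 0) : erlangMeasure r (Iic x) = 0 := by
  induction r generalizing x with
  | zero => simp [erlangMeasure, hx]
  | succ r ih =>
    rw [erlangMeasure_succ_Iic]
    refine setLIntegral_eq_zero measurableSet_Ioi fun t (ht : 0 < t) => ?_
    simp only [ih (by linarith : x - t < 0), mul_zero, Pi.zero_apply]

lemma erlangMeasure_succ_Iic_eq_setLIntegral_Ioc (r : ℕ) (x : ℝ) :
    erlangMeasure (r + 1) (Iic x) =
      ∫⁻ t in Ioc 0 x, ENNReal.ofReal (Real.exp (-t)) * erlangMeasure r (Iic (x - t)) := by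
  rw [erlangMeasure_succ_Iic]
  have hsupp : (fun t => ENNReal.ofReal (Real.exp (-t)) *
      erlangMeasure r (Iic (x - t))).support ⊆ Iic x := fun t ht => by
    by_contra hxt
    exact ht (by
      simp only [erlangMeasure_Iic_of_neg r (sub_neg.2 (not_le.1 hxt)), mul_zero])
  rw [← setLIntegral_eq_of_support_subset hsupp, Measure.restrict_restrict measurableSet_Iic,
    Iic_inter_Ioi]

lemma setLIntegral_Ioc_sub_pow_div_factorial {c : ℝ} (hc : 0 ≤ c) (r : ℕ) {x : ℝ} (hx : 0 ≤ x) :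
    ∫⁻ t in Ioc 0 x, ENNReal.ofReal (c * ((x - t) ^ r / r.factorial)) =
      ENNReal.ofReal (c * (x ^ (r + 1) / (r + 1).factorial)) := by
  rw [← ofReal_integral_eq_lintegral_ofReal]
  · rw [← intervalIntegral.integral_of_le hx, intervalIntegral.integral_const_mul,
      intervalIntegral.integral_div,
      intervalIntegral.integral_comp_sub_left (fun t => t ^ r) x, integral_pow, sub_self, sub_zero,
      zero_pow r.succ_ne_zero, sub_zero, Nat.factorial_succ, div_div]
    push_cast
    rfl
  · exact (Continuous.integrableOn_Icc (by fun_prop)).mono_set Ioc_subset_Icc_self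
  · refine ae_restrict_of_forall_mem measurableSet_Ioc fun t ht => ?_
    have : 0 ≤ x - t := sub_nonneg.2 ht.2
    positivity

lemma erlangMeasure_Iic_le (r : ℕ) {x : ℝ} (hx : 0 ≤ x) :
    erlangMeasure r (Iic x) ≤ ENNReal.ofReal (x ^ r / r.factorial) := by
  induction r generalizing x with
  | zero => simp [erlangMeasure, hx]
  | succ r ih =>
    rw [erlangMeasure_succ_Iic_eq_setLIntegral_Ioc, ← one_mul (x ^ (r + 1) / _),
      ← setLIntegral_Ioc_sub_pow_div_factorial zero_le_one r hx]
    refine setLIntegral_mono' measurableSet_Ioc fun t ht => ?_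
    rw [ENNReal.ofReal_mul zero_le_one]
    gcongr
    · exact Real.exp_le_one_iff.2 (neg_nonpos.2 ht.1.le)
    · exact ih (sub_nonneg.2 ht.2)

lemma le_erlangMeasure_Iic (r : ℕ) {x : ℝ} (hx : 0 ≤ x) :
    ENNReal.ofReal (Real.exp (-x) * (x ^ r / r.factorial)) ≤ erlangMeasure r (Iic x) := by
  induction r generalizing x with
  | zero => simp [erlangMeasure, hx]
  | succ r ih =>
    rw [erlangMeasure_succ_Iic_eq_setLIntegral_Ioc,
      ← setLIntegral_Ioc_sub_pow_div_factorial (Real.exp_pos _).le r hx]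
    refine setLIntegral_mono' measurableSet_Ioc fun t ht => ?_
    calc ENNReal.ofReal (Real.exp (-x) * ((x - t) ^ r / r.factorial))
        = ENNReal.ofReal (Real.exp (-t)) *
          ENNReal.ofReal (Real.exp (-(x - t)) * ((x - t) ^ r / r.factorial)) := by
          rw [← ENNReal.ofReal_mul (Real.exp_pos _).le, ← mul_assoc, ← Real.exp_add]
          ring_nf
      _ ≤ _ := by
          gcongr
          exact ih (sub_nonneg.2 ht.2)

/-- The probability that a sum of `r` independent standard exponential variables exceeds `x`. -/
noncomputable def erlangTail (r : ℕ) (x : ℝ) : ℝ := (erlangMeasure r).real (Ioi x)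

lemma erlangTail_nonneg (r : ℕ) (x : ℝ) : 0 ≤ erlangTail r x := measureReal_nonneg

lemma erlangTail_le_one (r : ℕ) (x : ℝ) : erlangTail r x ≤ 1 := measureReal_le_one

lemma ofReal_erlangTail (r : ℕ) (x : ℝ) :
    ENNReal.ofReal (erlangTail r x) = erlangMeasure r (Ioi x) :=
  ofReal_measureReal

lemma antitone_erlangTail (r : ℕ) : Antitone (erlangTail r) := fun _ _ h =>
  measureReal_mono (Ioi_subset_Ioi h)

@[fun_prop]
lemma measurable_erlangTail (r : ℕ) : Measurable (erlangTail r) :=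
  (antitone_erlangTail r).measurable

lemma one_sub_erlangTail (r : ℕ) (x : ℝ) :
    1 - erlangTail r x = (erlangMeasure r).real (Iic x) := by
  rw [erlangTail, ← compl_Iic, probReal_compl_eq_one_sub measurableSet_Iic, sub_sub_cancel]

lemma one_sub_erlangTail_le (r : ℕ) {x : ℝ} (hx : 0 ≤ x) :
    1 - erlangTail r x ≤ x ^ r / r.factorial := by
  rw [one_sub_erlangTail]
  exact ENNReal.toReal_le_of_le_ofReal (by positivity) (erlangMeasure_Iic_le r hx)

lemma le_one_sub_erlangTail (r : ℕ) {x : ℝ} (hx : 0 ≤ x) :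
    Real.exp (-x) * (x ^ r / r.factorial) ≤ 1 - erlangTail r x := by
  rw [one_sub_erlangTail]
  exact (ENNReal.ofReal_le_iff_le_toReal (measure_ne_top _ _)).1 (le_erlangMeasure_Iic r hx)

section Independence

variable {Ω : Type*} [MeasurableSpace Ω] {P : Measure Ω} {ι κ : Type*}

lemma indepFun_restrict_finsetSum {M : Type*} [AddCommMonoid M] [MeasurableSpace M]
    [MeasurableAdd₂ M] {X : ι → Ω → M} (hX : ∀ i, AEMeasurable (X i) P) (hind : iIndepFun X P)
    {S : Finset ι} {W : Finset κ} {s : κ → Finset ι} (hS : ∀ w ∈ W, Disjoint S (s w)) :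
    IndepFun (fun ω (i : S) => X i ω) (fun ω (w : W) => ∑ i ∈ s w, X i ω) P := by
  classical
  have hdisj : Disjoint S (W.biUnion s) := (Finset.disjoint_biUnion_right _ _ _).2 hS
  have hmem : ∀ w : W, ∀ i : s w, (i : ι) ∈ W.biUnion s := fun w i =>
    Finset.mem_biUnion.2 ⟨w, w.2, i.2⟩
  have hψ : Measurable fun (f : W.biUnion s → M) (w : W) => ∑ i : s w, f ⟨i, hmem w i⟩ := by
    fun_prop
  refine ((hind.indepFun_finset₀ _ _ hdisj hX).comp measurable_id hψ).congr .rfl ?_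
  refine ae_of_all _ fun ω => funext fun w => ?_
  exact Finset.sum_coe_sort (s w) fun i => X i ω

lemma iIndepFun_finsetSum {M : Type*} [AddCommMonoid M] [MeasurableSpace M]
    [MeasurableAdd₂ M] {X : ι → Ω → M} (hX : ∀ i, AEMeasurable (X i) P) (hind : iIndepFun X P)
    {s : κ → Finset ι} (hs : Pairwise (Function.onFun Disjoint s)) :
    iIndepFun (fun w ω => ∑ i ∈ s w, X i ω) P := by
  classical
  have := hind.isProbabilityMeasure
  refine iIndepFun_iff_measure_inter_preimage_eq_mul.2 fun W A hA => ?_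
  induction W using Finset.induction_on with
  | empty => simp
  | insert a W ha ih =>
    have hsum : Measurable fun f : s a → M => ∑ i, f i := by fun_prop
    have hindep := (indepFun_restrict_finsetSum hX hind (S := s a) (W := W) fun w hw =>
      hs (ne_of_mem_of_not_mem hw ha).symm).measure_inter_preimage_eq_mul _
      {g | ∀ w : W, g w ∈ A w} (hsum (hA a (Finset.mem_insert_self a W)))
      (by
        simp only [ofPred_forall]
        exact .iInter fun w =>
          measurable_pi_apply w (hA w (Finset.mem_insert_of_mem w.2)))
    rw [Finset.prod_insert ha, ← ih fun w hw => hA w (Finset.mem_insert_of_mem hw),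
      Finset.set_biInter_insert]
    convert hindep using 3 <;> ext ω <;> simp [← Finset.sum_coe_sort (s a)]

lemma measure_forall_lt_eq_lintegral {α : Type*} [MeasurableSpace α] {Y : Ω → α}
    {X : κ → Ω → ℝ} (hY : AEMeasurable Y P) (hX : ∀ w, AEMeasurable (X w) P) {W : Finset κ}
    (hYX : IndepFun Y (fun ω (w : W) => X w ω) P) (hind : iIndepFun X P) {c : α → κ → ℝ}
    (hc : ∀ w, Measurable fun y => c y w) :
    P {ω | ∀ w ∈ W, c (Y ω) w < X w ω} =
      ∫⁻ y, ∏ w ∈ W, P {ω | c y w < X w ω} ∂(P.map Y) := by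
  have := hind.isProbabilityMeasure
  have hX' : AEMeasurable (fun ω (w : W) => X w ω) P := by fun_prop
  have : IsProbabilityMeasure (P.map fun ω (w : W) => X w ω) := Measure.isProbabilityMeasure_map hX'
  set D : Set (α × (W → ℝ)) := {q | ∀ w : W, c q.1 w < q.2 w} with hD
  have hDm : MeasurableSet D := by
    simp only [hD, ofPred_forall]
    exact .iInter fun w => measurableSet_lt ((hc w).comp measurable_fst) (by fun_prop)
  calc P {ω | ∀ w ∈ W, c (Y ω) w < X w ω}
      = P.map (fun ω => (Y ω, fun w : W => X w ω)) D := by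
        rw [Measure.map_apply_of_aemeasurable (hY.prodMk hX') hDm]
        congr 1
        ext ω
        simp [hD]
    _ = ∫⁻ y, P.map (fun ω (w : W) => X w ω) (Prod.mk y ⁻¹' D) ∂(P.map Y) := by
        rw [hYX.map_prod_eq_prod_map_map hY hX', Measure.prod_apply hDm]
    _ = _ := by
        refine lintegral_congr fun y => ?_
        rw [Measure.map_apply_of_aemeasurable hX' (hDm.preimage measurable_prodMk_left)]
        rw [show (∏ w ∈ W, P {ω | c y w < X w ω}) = ∏ w ∈ W, P (X w ⁻¹' Ioi (c y w)) from rfl,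
          ← hind.measure_inter_preimage_eq_mul W (sets := fun w => Ioi (c y w))
            fun w _ => measurableSet_Ioi]
        congr 1
        ext ω
        simp [hD]

lemma hasLaw_finsetSum_erlangMeasure {X : ι → Ω → ℝ} (hX : ∀ i, HasLaw (X i) (expMeasure 1) P)
    (hind : iIndepFun X P) (s : Finset ι) :
    HasLaw (∑ i ∈ s, X i) (erlangMeasure s.card) P := by
  classical
  have := hind.isProbabilityMeasure
  induction s using Finset.induction_on with
  | empty => exact hasLaw_dirac_of_ae_eq (ae_of_all _ fun _ => rfl)
  | insert a s ha ih =>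
    rw [Finset.sum_insert ha, Finset.card_insert_of_notMem ha, erlangMeasure]
    exact (hind.indepFun_finsetSum_of_notMem₀ (fun i => (hX i).aemeasurable) ha).symm.hasLaw_add
      (hX a) ih

end Independence

/-- The time between the `a`-th and the `b`-th ring of node `v`. -/
noncomputable def waitTime {Ω : Type*} (T : ℕ → ℕ → Ω → ℝ) (a b v : ℕ) (ω : Ω) : ℝ :=
  ∑ i ∈ Finset.Ico a b, T i v ω

section Records

lemma prod_range_eq_of_lt {M : Type*} [CommMonoid M] {u v : ℕ} (huv : u < v) (p q r : M) :
    ∏ w ∈ Finset.range v, (if w < u then p else if w = u then q else r) =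
      q * (p ^ u * r ^ (v - 1 - u)) := by
  obtain ⟨d, rfl⟩ := Nat.exists_eq_add_of_lt huv
  rw [add_assoc, Finset.prod_range_add, Finset.prod_range_succ', Finset.prod_congr rfl fun w hw =>
    if_pos (Finset.mem_range.1 hw)]
  simp [mul_left_comm, mul_comm]

variable {Ω : Type*} {T : ℕ → ℕ → Ω → ℝ}

lemma ringTime_eq_waitTime (T : ℕ → ℕ → Ω → ℝ) (k v : ℕ) :
    ringTime T k v = waitTime T 0 k v := by
  ext ω
  rw [ringTime, waitTime, Finset.range_eq_Ico]

lemma ringTime_one (T : ℕ → ℕ → Ω → ℝ) (v : ℕ) (ω : Ω) : ringTime T 1 v ω = T 0 v ω := by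
  simp [ringTime]

lemma ringTime_eq_add_waitTime {k : ℕ} (hk : 1 ≤ k) (v : ℕ) (ω : Ω) :
    ringTime T k v ω = T 0 v ω + waitTime T 1 k v ω := by
  rw [ringTime, waitTime, Finset.range_eq_Ico, Finset.sum_eq_sum_Ico_succ_bot hk]

-- Node `u` rings at `T 0 u`, so the record at `v` constrains only the rest of its waiting time,
-- which is independent of `T 0 u`.
lemma recordEvent_inter_recordEvent {k : ℕ} (hk : 1 ≤ k) {u v : ℕ} (huv : u < v) :
    recordEvent T k 1 u ∩ recordEvent T k 1 v = {ω | ∀ w ∈ Finset.range v,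
      (if w < u then max (T 0 u ω) (T 0 v ω) else if w = u then T 0 v ω - T 0 u ω else T 0 v ω) <
        waitTime T (if w = u then 1 else 0) k w ω} := by
  ext ω
  simp only [recordEvent, ringTime_one, mem_inter_iff, mem_ofPred_eq, Finset.mem_range]
  constructor
  · rintro ⟨hu, hv⟩ w hw
    rcases lt_trichotomy w u with hwu | rfl | huw
    · simpa only [if_pos hwu, if_neg hwu.ne, ← ringTime_eq_waitTime] using
        max_lt (hu w hwu) (hv w hw)
    · simpa only [lt_irrefl, if_false, if_true, sub_lt_iff_lt_add',
        ← ringTime_eq_add_waitTime hk] using hv w hw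
    · simpa only [if_neg huw.not_gt, if_neg huw.ne', ← ringTime_eq_waitTime] using hv w hw
  · intro h
    have hlt : ∀ w < u, max (T 0 u ω) (T 0 v ω) < ringTime T k w ω := fun w hwu => by
      simpa only [if_pos hwu, if_neg hwu.ne, ← ringTime_eq_waitTime] using h w (hwu.trans huv)
    refine ⟨fun w hwu => (le_max_left _ _).trans_lt (hlt w hwu), fun w hw => ?_⟩
    rcases lt_trichotomy w u with hwu | rfl | huw
    · exact (le_max_right _ _).trans_lt (hlt w hwu)
    · simpa only [lt_irrefl, if_false, if_true, sub_lt_iff_lt_add',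
        ← ringTime_eq_add_waitTime hk] using h w hw
    · simpa only [if_neg huw.not_gt, if_neg huw.ne', ← ringTime_eq_waitTime] using h w hw

variable [MeasurableSpace Ω] {P : Measure Ω}

lemma aemeasurable_ringTime (hT : ∀ i v, AEMeasurable (T i v) P) (k v : ℕ) :
    AEMeasurable (ringTime T k v) P := by
  unfold ringTime
  fun_prop

lemma nullMeasurableSet_recordEvent (hT : ∀ i v, AEMeasurable (T i v) P) (k r v : ℕ) :
    NullMeasurableSet (recordEvent T k r v) P := by
  simp only [recordEvent, ofPred_forall]
  exact .iInter fun u => .iInter fun _ =>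
    nullMeasurableSet_lt (aemeasurable_ringTime hT r v) (aemeasurable_ringTime hT k u)

variable (hlaw : ∀ i v, HasLaw (T i v) (expMeasure 1) P)
  (hind : iIndepFun (fun p : ℕ × ℕ => T p.1 p.2) P)

include hlaw hind

lemma measure_lt_waitTime (a b v : ℕ) (x : ℝ) :
    P {ω | x < waitTime T a b v ω} = ENNReal.ofReal (erlangTail (b - a) x) := by
  have hsum := hasLaw_finsetSum_erlangMeasure (fun i => hlaw i v)
    (hind.precomp (Prod.mk_left_injective v)) (Finset.Ico a b)
  rw [Nat.card_Ico] at hsum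
  rw [ofReal_erlangTail, ← hsum.map_eq, Measure.map_apply_of_aemeasurable hsum.aemeasurable
    measurableSet_Ioi]
  simp [waitTime, preimage, ofPred]

lemma measure_forall_lt_waitTime {α : Type*} [MeasurableSpace α] {S : Finset (ℕ × ℕ)}
    {φ : (S → ℝ) → α} (hφ : Measurable φ) {W : Finset ℕ} {a : ℕ → ℕ}
    (hS : ∀ w ∈ W, ∀ i, a w ≤ i → (i, w) ∉ S) (k : ℕ) {c : α → ℕ → ℝ}
    (hc : ∀ w, Measurable fun y => c y w) :
    P {ω | ∀ w ∈ W, c (φ fun p => T p.1.1 p.1.2 ω) w < waitTime T (a w) k w ω} =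
      ∫⁻ y, ENNReal.ofReal (∏ w ∈ W, erlangTail (k - a w) (c y w))
        ∂(P.map fun ω => φ fun p => T p.1.1 p.1.2 ω) := by
  have hT : ∀ p : ℕ × ℕ, AEMeasurable (T p.1 p.2) P := fun p => (hlaw p.1 p.2).aemeasurable
  set s : ℕ → Finset (ℕ × ℕ) := fun w => Finset.Ico (a w) k ×ˢ {w}
  have hs : Pairwise (Function.onFun Disjoint s) := fun v w hvw =>
    Finset.disjoint_product.2 (.inr (Finset.disjoint_singleton.2 hvw))
  have hS' : ∀ w ∈ W, Disjoint S (s w) := fun w hw => Finset.disjoint_right.2 fun p hp => by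
    obtain ⟨hp₁, hp₂⟩ := Finset.mem_product.1 hp
    have := hS w hw p.1 (Finset.mem_Ico.1 hp₁).1
    rwa [← Finset.mem_singleton.1 hp₂] at this
  have hsum : ∀ w, (fun ω => ∑ p ∈ s w, T p.1 p.2 ω) = waitTime T (a w) k w := fun w => by
    ext ω
    simp [s, waitTime]
  have hindep : IndepFun (fun ω => φ fun p => T p.1.1 p.1.2 ω)
      (fun ω (w : W) => waitTime T (a w) k w ω) P := by
    simpa only [← hsum] using! (indepFun_restrict_finsetSum hT hind hS').comp hφ measurable_id
  have hiindep := iIndepFun_finsetSum hT hind hs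
  rw [funext hsum] at hiindep
  rw [measure_forall_lt_eq_lintegral (Y := fun ω => φ fun p => T p.1.1 p.1.2 ω)
    (hφ.comp_aemeasurable (by fun_prop)) (fun w => by unfold waitTime; fun_prop) hindep hiindep hc]
  simp only [measure_lt_waitTime hlaw hind,
    ← ENNReal.ofReal_prod_of_nonneg fun _ _ => erlangTail_nonneg _ _]

lemma measure_recordEvent (k v : ℕ) :
    P (recordEvent T k 1 v) = ∫⁻ x, ENNReal.ofReal (erlangTail k x ^ v) ∂(expMeasure 1) := by
  have hmeasure := measure_forall_lt_waitTime hlaw hind (S := {(0, v)}) (W := Finset.range v)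
    (φ := fun f => f ⟨(0, v), Finset.mem_singleton_self _⟩) (by fun_prop) (a := fun _ => 0)
    (fun w hw i _ => by simp [(Finset.mem_range.1 hw).ne]) k (c := fun x _ => x)
    fun _ => measurable_id
  simpa [(hlaw 0 v).map_eq, recordEvent, ringTime_one, ringTime_eq_waitTime] using hmeasure

lemma measure_recordEvent_inter {k : ℕ} (hk : 1 ≤ k) {u v : ℕ} (huv : u < v) :
    P (recordEvent T k 1 u ∩ recordEvent T k 1 v) =
      ∫⁻ z, ENNReal.ofReal (erlangTail (k - 1) (z.2 - z.1) *
        (erlangTail k (max z.1 z.2) ^ u * erlangTail k z.2 ^ (v - 1 - u)))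
        ∂((expMeasure 1).prod (expMeasure 1)) := by
  have hmap : P.map (fun ω => (T 0 u ω, T 0 v ω)) = (expMeasure 1).prod (expMeasure 1) := by
    have := hind.isProbabilityMeasure
    have hindep : IndepFun (T 0 u) (T 0 v) P :=
      hind.indepFun (i := (0, u)) (j := (0, v)) (by simp [huv.ne])
    rw [hindep.map_prod_eq_prod_map_map (hlaw 0 u).aemeasurable (hlaw 0 v).aemeasurable,
      (hlaw 0 u).map_eq, (hlaw 0 v).map_eq]
  have hmeasure := measure_forall_lt_waitTime hlaw hind (S := {(0, u), (0, v)})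
    (W := Finset.range v) (φ := fun f => (f ⟨(0, u), by simp⟩, f ⟨(0, v), by simp⟩)) (by fun_prop)
    (a := fun w => if w = u then 1 else 0)
    (fun w hw i hi => by
      have := Finset.mem_range.1 hw
      simp only [Finset.mem_insert, Finset.mem_singleton, Prod.mk.injEq]
      split_ifs at hi <;> omega) k
    (c := fun z w => if w < u then max z.1 z.2 else if w = u then z.2 - z.1 else z.2)
    fun w => by split_ifs <;> fun_prop
  rw [recordEvent_inter_recordEvent hk huv, hmeasure, hmap]
  refine lintegral_congr fun z => ?_
  rw [← prod_range_eq_of_lt huv]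
  congr 1
  refine Finset.prod_congr rfl fun w _ => ?_
  rcases lt_trichotomy w u with hwu | rfl | huw
  · simp [hwu, hwu.ne]
  · simp
  · simp [huw.not_gt, huw.ne']

end Records

/-- The weight `∑_{u < v < n} p ^ u * q ^ (v - 1 - u)` which the positions `u < v` of two records
contribute to the second factorial moment. -/
noncomputable def pairSum (n : ℕ) (p q : ℝ) : ℝ :=
  ∑ v ∈ Finset.range n, ∑ u ∈ Finset.range v, p ^ u * q ^ (v - 1 - u)

/-- The open quadrant of values `(x, y)` of `(T 0 u, T 0 v)`. -/
abbrev quadrant : Set (ℝ × ℝ) := Ioi 0 ×ˢ Ioi 0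

lemma measurableSet_quadrant : MeasurableSet quadrant := measurableSet_Ioi.prod measurableSet_Ioi

/-- The intensity at `x` of the times `T 0 v` of the one-records `v < n`. -/
noncomputable def recordDensity (k n : ℕ) (x : ℝ) : ℝ :=
  Real.exp (-x) * ∑ v ∈ Finset.range n, erlangTail k x ^ v

/-- The intensity at `z` of the times `(T 0 u, T 0 v)` of the pairs `u < v < n` of one-records. The
nodes before `u` must respect both times, those between `u` and `v` only the second one. -/
noncomputable def recordPairDensity (k n : ℕ) (z : ℝ × ℝ) : ℝ :=
  Real.exp (-z.1) * Real.exp (-z.2) * (erlangTail (k - 1) (z.2 - z.1) *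
    pairSum n (erlangTail k (max z.1 z.2)) (erlangTail k z.2))

section Moments

lemma integral_eq_toReal_lintegral_ofReal {α : Type*} [MeasurableSpace α] {μ : Measure α}
    {f : α → ℝ} (hf : Measurable f) (h0 : ∀ x, 0 ≤ f x) :
    ∫ x, f x ∂μ = (∫⁻ x, ENNReal.ofReal (f x) ∂μ).toReal :=
  integral_eq_lintegral_of_nonneg_ae (ae_of_all _ h0) hf.aestronglyMeasurable

lemma integrable_of_forall_mem_Icc {α : Type*} [MeasurableSpace α] {μ : Measure α}
    [IsFiniteMeasure μ] {f : α → ℝ} (hf : Measurable f) {a b : ℝ} (h : ∀ x, f x ∈ Icc a b) :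
    Integrable f μ :=
  .of_mem_Icc a b hf.aemeasurable (ae_of_all _ h)

lemma erlangTail_pow_mem_Icc (r v : ℕ) (x : ℝ) : erlangTail r x ^ v ∈ Icc (0 : ℝ) 1 :=
  ⟨pow_nonneg (erlangTail_nonneg _ _) _,
    pow_le_one₀ (erlangTail_nonneg _ _) (erlangTail_le_one _ _)⟩

variable {Ω : Type*}

lemma recordCount_succ (T : ℕ → ℕ → Ω → ℝ) (k n r : ℕ) (ω : Ω) :
    recordCount T k (n + 1) r ω =
      recordCount T k n r ω + (recordEvent T k r n).indicator (fun _ => (1 : ℝ)) ω :=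
  Finset.sum_range_succ _ _

lemma recordCount_mul_sub_one (T : ℕ → ℕ → Ω → ℝ) (k n r : ℕ) (ω : Ω) :
    recordCount T k n r ω * (recordCount T k n r ω - 1) =
      2 * ∑ v ∈ Finset.range n, ∑ u ∈ Finset.range v,
        (recordEvent T k r u ∩ recordEvent T k r v).indicator (fun _ => (1 : ℝ)) ω := by
  have hinter : ∀ A B : Set Ω, (A ∩ B).indicator (fun _ => (1 : ℝ)) ω =
      A.indicator (fun _ => 1) ω * B.indicator (fun _ => 1) ω := fun A B => by
    rw [← inter_indicator_mul, one_mul]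
  induction n with
  | zero => simp [recordCount]
  | succ n ih =>
    have hsum : ∑ u ∈ Finset.range n,
        (recordEvent T k r u ∩ recordEvent T k r n).indicator (fun _ => (1 : ℝ)) ω =
        recordCount T k n r ω * (recordEvent T k r n).indicator (fun _ => (1 : ℝ)) ω := by
      rw [recordCount, Finset.sum_mul]
      exact Finset.sum_congr rfl fun u _ => hinter _ _
    have hself := hinter (recordEvent T k r n) (recordEvent T k r n)
    rw [inter_self] at hself
    rw [Finset.sum_range_succ, mul_add, ← ih, hsum, recordCount_succ]
    linear_combination -hself

lemma recordCount_mem_Icc (T : ℕ → ℕ → Ω → ℝ) (k n r : ℕ) (ω : Ω) :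
    recordCount T k n r ω ∈ Icc (0 : ℝ) n := by
  refine ⟨Finset.sum_nonneg fun _ _ => indicator_nonneg (fun _ _ => zero_le_one) _, ?_⟩
  refine (Finset.sum_le_sum fun v _ => indicator_le_self' (fun _ _ => zero_le_one) ω).trans ?_
  simp

variable [MeasurableSpace Ω] {P : Measure Ω} {T : ℕ → ℕ → Ω → ℝ}

lemma aemeasurable_recordCount (hT : ∀ i v, AEMeasurable (T i v) P) (k n r : ℕ) :
    AEMeasurable (recordCount T k n r) P :=
  Finset.aemeasurable_fun_sum _ fun v _ =>
    aemeasurable_const.indicator₀ (nullMeasurableSet_recordEvent hT k r v)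

lemma memLp_recordCount [IsFiniteMeasure P] (hT : ∀ i v, AEMeasurable (T i v) P) (k n r : ℕ) :
    MemLp (recordCount T k n r) 2 P :=
  memLp_of_bounded (ae_of_all _ (recordCount_mem_Icc T k n r))
    (aemeasurable_recordCount hT k n r).aestronglyMeasurable 2

variable (hlaw : ∀ i v, HasLaw (T i v) (expMeasure 1) P)
  (hind : iIndepFun (fun p : ℕ × ℕ => T p.1 p.2) P)

include hlaw hind

lemma integral_recordCount (k n : ℕ) :
    ∫ ω, recordCount T k n 1 ω ∂P =
      ∫ x in Ioi 0, recordDensity k n x := by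
  have := hind.isProbabilityMeasure
  have hmeas := nullMeasurableSet_recordEvent (fun i v => (hlaw i v).aemeasurable) k 1
  simp only [recordCount, recordDensity]
  rw [integral_finsetSum _ fun v _ => (integrable_const (1 : ℝ)).indicator₀ (hmeas v),
    ← integral_expMeasure_one, integral_finsetSum _ fun v _ =>
      integrable_of_forall_mem_Icc (by fun_prop) fun x => erlangTail_pow_mem_Icc k v x]
  refine Finset.sum_congr rfl fun v _ => ?_
  rw [integral_indicator₀ (hmeas v), setIntegral_const, smul_eq_mul, mul_one, measureReal_def,
    measure_recordEvent hlaw hind, integral_eq_toReal_lintegral_ofReal (by fun_prop)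
      fun x => (erlangTail_pow_mem_Icc k v x).1]

lemma integral_recordCount_mul_sub_one {k : ℕ} (hk : 1 ≤ k) (n : ℕ) :
    ∫ ω, recordCount T k n 1 ω * (recordCount T k n 1 ω - 1) ∂P =
      2 * ∫ z in quadrant, recordPairDensity k n z := by
  have := hind.isProbabilityMeasure
  have hmeas := nullMeasurableSet_recordEvent (fun i v => (hlaw i v).aemeasurable) k 1
  have hint : ∀ u v, Integrable
      ((recordEvent T k 1 u ∩ recordEvent T k 1 v).indicator fun _ => (1 : ℝ)) P := fun u v =>
    (integrable_const (1 : ℝ)).indicator₀ ((hmeas u).inter (hmeas v))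
  have hmem : ∀ (u v : ℕ) (z : ℝ × ℝ), erlangTail (k - 1) (z.2 - z.1) *
      (erlangTail k (max z.1 z.2) ^ u * erlangTail k z.2 ^ (v - 1 - u)) ∈ Icc (0 : ℝ) 1 :=
    fun u v z => unitInterval.mul_mem ⟨erlangTail_nonneg _ _, erlangTail_le_one _ _⟩
      (unitInterval.mul_mem (erlangTail_pow_mem_Icc _ _ _) (erlangTail_pow_mem_Icc _ _ _))
  have hint' : ∀ u v : ℕ, Integrable (fun z : ℝ × ℝ => erlangTail (k - 1) (z.2 - z.1) *
      (erlangTail k (max z.1 z.2) ^ u * erlangTail k z.2 ^ (v - 1 - u)))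
      ((expMeasure 1).prod (expMeasure 1)) := fun u v =>
    integrable_of_forall_mem_Icc (by fun_prop) (hmem u v)
  simp_rw [recordCount_mul_sub_one, recordPairDensity]
  rw [integral_const_mul, ← integral_expMeasure_one_prod]
  congr 1
  simp_rw [pairSum, Finset.mul_sum]
  rw [integral_finsetSum _ fun v _ => integrable_finsetSum _ fun u _ => hint u v,
    integral_finsetSum _ fun v _ => integrable_finsetSum _ fun u _ => hint' u v]
  refine Finset.sum_congr rfl fun v _ => ?_
  rw [integral_finsetSum _ fun u _ => hint u v, integral_finsetSum _ fun u _ => hint' u v]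
  refine Finset.sum_congr rfl fun u hu => ?_
  rw [integral_indicator₀ ((hmeas u).inter (hmeas v)), setIntegral_const, smul_eq_mul, mul_one,
    measureReal_def, measure_recordEvent_inter hlaw hind hk (Finset.mem_range.1 hu),
    integral_eq_toReal_lintegral_ofReal (by fun_prop) fun z => (hmem u v z).1]

end Moments

/-- The moments `∫₀¹ ρ ^ i * exp (-ρ σ) dρ`. For `i = 0` this is the limit of
`n⁻¹ * ∑ v < n, p ^ v` when `n (1 - p) → σ`. -/
noncomputable def expMoment (i : ℕ) (σ : ℝ) : ℝ := ∫ ρ in (0 : ℝ)..1, ρ ^ i * Real.exp (-(ρ * σ))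

/-- The integral of `exp (-(a * σ + c * τ))` over the triangle `a, c ≥ 0`, `a + c ≤ 1`, written in
the coordinates `a = ρ (1 - p)`, `c = ρ p` and integrated over `ρ`. It is the limit of
`n⁻² * pairSum n p q` when `n (1 - p) → σ` and `n (1 - q) → τ`. -/
noncomputable def expPairMean (σ τ : ℝ) : ℝ :=
  ∫ p in (0 : ℝ)..1, expMoment 1 ((1 - p) * σ + p * τ)

@[fun_prop]
lemma continuous_expMoment (i : ℕ) : Continuous (expMoment i) :=
  intervalIntegral.continuous_parametric_intervalIntegral_of_continuous' (by fun_prop) 0 1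

lemma expMoment_nonneg (i : ℕ) (σ : ℝ) : 0 ≤ expMoment i σ :=
  intervalIntegral.integral_nonneg zero_le_one fun _ hρ =>
    mul_nonneg (pow_nonneg hρ.1 i) (Real.exp_pos _).le

lemma expMoment_zero {σ : ℝ} (hσ : σ ≠ 0) : expMoment 0 σ = (1 - Real.exp (-σ)) / σ := by
  simp only [expMoment, pow_zero, one_mul, ← mul_neg]
  rw [intervalIntegral.integral_comp_mul_right Real.exp (neg_ne_zero.2 hσ), integral_exp, zero_mul,
    one_mul, Real.exp_zero, smul_eq_mul, inv_neg]
  ring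

lemma expMoment_one {σ : ℝ} (hσ : σ ≠ 0) :
    expMoment 1 σ = (1 - Real.exp (-σ) - σ * Real.exp (-σ)) / σ ^ 2 := by
  have hderiv : ∀ ρ ∈ uIcc (0 : ℝ) 1, HasDerivAt
      (fun ρ => -Real.exp (-(ρ * σ)) * (ρ / σ + 1 / σ ^ 2)) (ρ ^ 1 * Real.exp (-(ρ * σ))) ρ := by
    intro ρ _
    convert! (hasDerivAt_mul_const σ).fun_neg.exp.fun_neg.fun_mul
      (((hasDerivAt_id' ρ).div_const σ).add_const (1 / σ ^ 2)) using 1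
    field_simp
    ring
  rw [expMoment, intervalIntegral.integral_eq_sub_of_hasDerivAt hderiv
    (Continuous.intervalIntegrable (by fun_prop) _ _)]
  simp only [one_mul, zero_mul, zero_div, neg_zero, Real.exp_zero, zero_add]
  field_simp
  ring

lemma integral_expMoment_succ (i : ℕ) (τ σ : ℝ) :
    ∫ x in τ..σ, expMoment (i + 1) x = expMoment i τ - expMoment i σ := by
  have hinner : ∀ ρ : ℝ, ∫ x in τ..σ, ρ ^ (i + 1) * Real.exp (-(ρ * x)) =
      ρ ^ i * Real.exp (-(ρ * τ)) - ρ ^ i * Real.exp (-(ρ * σ)) := by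
    intro ρ
    have hderiv : ∀ x ∈ uIcc τ σ, HasDerivAt (fun x => -(ρ ^ i * Real.exp (-(ρ * x))))
        (ρ ^ (i + 1) * Real.exp (-(ρ * x))) x := by
      intro x _
      convert! ((hasDerivAt_const_mul ρ).fun_neg.exp.const_mul (ρ ^ i)).fun_neg using 1
      ring
    rw [intervalIntegral.integral_eq_sub_of_hasDerivAt hderiv
      (Continuous.intervalIntegrable (by fun_prop) _ _)]
    ring
  calc ∫ x in τ..σ, expMoment (i + 1) x
      = ∫ ρ in (0 : ℝ)..1, ∫ x in τ..σ, ρ ^ (i + 1) * Real.exp (-(ρ * x)) := by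
        refine intervalIntegral_intervalIntegral_swap (IntegrableOn.mono_set ?_
          (prod_mono uIoc_subset_uIcc uIoc_subset_uIcc))
        exact ContinuousOn.integrableOn_compact (isCompact_uIcc.prod isCompact_uIcc)
          (Continuous.continuousOn (by fun_prop))
    _ = expMoment i τ - expMoment i σ := by
        simp only [hinner]
        exact intervalIntegral.integral_sub (Continuous.intervalIntegrable (by fun_prop) _ _)
          (Continuous.intervalIntegrable (by fun_prop) _ _)

lemma sub_mul_expPairMean (σ τ : ℝ) :
    (σ - τ) * expPairMean σ τ = ∫ x in τ..σ, expMoment 1 x := by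
  have haffine : ∀ p, (1 - p) * σ + p * τ = σ - (σ - τ) * p := fun p => by ring
  simp only [expPairMean, haffine]
  rw [intervalIntegral.mul_integral_comp_sub_mul]
  simp

lemma expPairMean_self (τ : ℝ) : expPairMean τ τ = expMoment 1 τ := by
  simp [expPairMean, ← add_mul]

lemma expPairMean_of_ne {σ τ : ℝ} (h : σ ≠ τ) :
    expPairMean σ τ = (expMoment 0 τ - expMoment 0 σ) / (σ - τ) := by
  rw [eq_div_iff (sub_ne_zero.2 h), mul_comm, sub_mul_expPairMean, integral_expMoment_succ]

section DiscreteLimits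

lemma tendsto_one_of_tendsto_mul {p : ℕ → ℝ} {σ : ℝ}
    (h : Tendsto (fun n : ℕ => (n : ℝ) * (1 - p n)) atTop (𝓝 σ)) : Tendsto p atTop (𝓝 1) := by
  have hgap : Tendsto (fun n => 1 - p n) atTop (𝓝 0) := by
    refine (mul_zero σ ▸ h.mul tendsto_inv_atTop_nhds_zero_nat).congr' ?_
    filter_upwards [eventually_gt_atTop 0] with n hn
    field_simp
  simpa using hgap.const_sub 1

lemma tendsto_pow_exp {p : ℕ → ℝ} {σ : ℝ}
    (h : Tendsto (fun n : ℕ => (n : ℝ) * (1 - p n)) atTop (𝓝 σ)) :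
    Tendsto (fun n => p n ^ n) atTop (𝓝 (Real.exp (-σ))) := by
  have hneg : Tendsto (fun n : ℕ => (n : ℝ) * (p n - 1)) atTop (𝓝 (-σ)) :=
    h.neg.congr fun n => by ring
  simpa using Real.tendsto_one_add_pow_exp_of_tendsto hneg

lemma tendsto_geom_mean {p : ℕ → ℝ} {σ : ℝ} (hσ : σ ≠ 0)
    (h : Tendsto (fun n : ℕ => (n : ℝ) * (1 - p n)) atTop (𝓝 σ)) :
    Tendsto (fun n : ℕ => (n : ℝ)⁻¹ * ∑ v ∈ Finset.range n, p n ^ v) atTop (𝓝 (expMoment 0 σ)) := by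
  rw [expMoment_zero hσ]
  refine (((tendsto_pow_exp h).const_sub 1).div h hσ).congr' ?_
  filter_upwards [h.eventually_ne hσ] with n hn
  have hn0 : (n : ℝ) ≠ 0 := left_ne_zero_of_mul hn
  have hgap : 1 - p n ≠ 0 := right_ne_zero_of_mul hn
  rw [Pi.div_apply, ← mul_neg_geom_sum]
  field_simp

lemma pairSum_mul_sub (n : ℕ) (p q : ℝ) :
    pairSum n p q * (p - q) = ∑ v ∈ Finset.range n, p ^ v - ∑ v ∈ Finset.range n, q ^ v := by
  rw [pairSum, Finset.sum_mul, ← Finset.sum_sub_distrib]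
  exact Finset.sum_congr rfl fun v _ => (Commute.all p q).geom_sum₂_mul v

lemma pairSum_self (n : ℕ) (p : ℝ) :
    (1 - p) ^ 2 * (p * pairSum n p p) = p * (1 - p ^ n) - n * (1 - p) * p ^ n := by
  induction n with
  | zero => simp [pairSum]
  | succ n ih =>
    have hlast : p * ∑ u ∈ Finset.range n, p ^ u * p ^ (n - 1 - u) = n * p ^ n := by
      rw [Finset.mul_sum, Finset.sum_congr rfl (g := fun _ => p ^ n)]
      · simp
      · intro u hu
        have := Finset.mem_range.1 hu
        rw [← pow_add, ← pow_succ']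
        congr 1
        omega
    have hsucc : pairSum (n + 1) p p =
        pairSum n p p + ∑ u ∈ Finset.range n, p ^ u * p ^ (n - 1 - u) :=
      Finset.sum_range_succ _ _
    rw [hsucc, mul_add p, mul_add, ih, hlast]
    push_cast
    ring

lemma tendsto_pairSum_of_ne {p q : ℕ → ℝ} {σ τ : ℝ} (hσ : σ ≠ 0) (hτ : τ ≠ 0) (hne : σ ≠ τ)
    (hp : Tendsto (fun n : ℕ => (n : ℝ) * (1 - p n)) atTop (𝓝 σ))
    (hq : Tendsto (fun n : ℕ => (n : ℝ) * (1 - q n)) atTop (𝓝 τ)) :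
    Tendsto (fun n : ℕ => ((n : ℝ) ^ 2)⁻¹ * pairSum n (p n) (q n)) atTop
      (𝓝 (expPairMean σ τ)) := by
  rw [expPairMean_of_ne hne]
  have hστ : σ - τ ≠ 0 := sub_ne_zero.2 hne
  have hdiff : Tendsto (fun n : ℕ => (n : ℝ) * (q n - p n)) atTop (𝓝 (σ - τ)) :=
    (hp.sub hq).congr fun n => by ring
  refine (((tendsto_geom_mean hτ hq).sub (tendsto_geom_mean hσ hp)).div hdiff hστ).congr' ?_
  filter_upwards [hdiff.eventually_ne hστ] with n hn
  have hn0 : (n : ℝ) ≠ 0 := left_ne_zero_of_mul hn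
  have hqp : q n - p n ≠ 0 := right_ne_zero_of_mul hn
  rw [Pi.div_apply, ← mul_sub, ← neg_sub (∑ v ∈ Finset.range n, p n ^ v), ← pairSum_mul_sub]
  field_simp
  ring

lemma tendsto_pairSum_self {p : ℕ → ℝ} {τ : ℝ} (hτ : τ ≠ 0)
    (hp : Tendsto (fun n : ℕ => (n : ℝ) * (1 - p n)) atTop (𝓝 τ)) :
    Tendsto (fun n : ℕ => ((n : ℝ) ^ 2)⁻¹ * pairSum n (p n) (p n)) atTop
      (𝓝 (expPairMean τ τ)) := by
  have hone := tendsto_one_of_tendsto_mul hp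
  have hpow := tendsto_pow_exp hp
  have hlim := ((hone.mul (hpow.const_sub 1)).sub (hp.mul hpow)).div ((hp.pow 2).mul hone)
    (by simpa using hτ)
  rw [expPairMean_self, expMoment_one hτ]
  simp only [one_mul, mul_one] at hlim
  refine hlim.congr' ?_
  filter_upwards [hp.eventually_ne hτ, hone.eventually_ne one_ne_zero] with n hn hpn
  have hn0 : (n : ℝ) ≠ 0 := left_ne_zero_of_mul hn
  have hgap : 1 - p n ≠ 0 := right_ne_zero_of_mul hn
  rw [Pi.div_apply, ← pairSum_self]
  field_simp

lemma tendsto_pairSum {p q : ℕ → ℝ} {σ τ : ℝ} (hσ : σ ≠ 0) (hτ : τ ≠ 0)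
    (hpq : σ = τ → p = q)
    (hp : Tendsto (fun n : ℕ => (n : ℝ) * (1 - p n)) atTop (𝓝 σ))
    (hq : Tendsto (fun n : ℕ => (n : ℝ) * (1 - q n)) atTop (𝓝 τ)) :
    Tendsto (fun n : ℕ => ((n : ℝ) ^ 2)⁻¹ * pairSum n (p n) (q n)) atTop
      (𝓝 (expPairMean σ τ)) := by
  by_cases h : σ = τ
  · obtain rfl := hpq h
    obtain rfl := h
    exact tendsto_pairSum_self hτ hq
  · exact tendsto_pairSum_of_ne hσ hτ h hp hq

lemma pairSum_nonneg (n : ℕ) {p q : ℝ} (hp : 0 ≤ p) (hq : 0 ≤ q) : 0 ≤ pairSum n p q :=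
  Finset.sum_nonneg fun _ _ => Finset.sum_nonneg fun _ _ => by positivity

lemma pairSum_le (n : ℕ) {p q : ℝ} (hp : 0 ≤ p) (hq : 0 ≤ q) :
    pairSum n p q ≤ (∑ v ∈ Finset.range n, p ^ v) * ∑ v ∈ Finset.range n, q ^ v := by
  have hswap : pairSum n p q =
      ∑ u ∈ Finset.range n, ∑ v ∈ Finset.Ico (u + 1) n, p ^ u * q ^ (v - 1 - u) := by
    refine Finset.sum_comm' fun v u => ?_
    simp only [Finset.mem_range, Finset.mem_Ico]
    omega
  rw [hswap, Finset.sum_mul]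
  refine Finset.sum_le_sum fun u _ => ?_
  rw [← Finset.mul_sum, Finset.sum_Ico_eq_sum_range]
  refine mul_le_mul_of_nonneg_left ?_ (by positivity)
  rw [Finset.sum_congr rfl (g := fun i => q ^ i) fun i _ => by congr 1; omega]
  exact Finset.sum_le_sum_of_subset_of_nonneg (Finset.range_mono (Nat.sub_le _ _))
    fun _ _ _ => by positivity

end DiscreteLimits

section Scaling

/-- The spatial scale `n ^ (1 / k)`, the inverse of the order of magnitude of the time of a typical
record among `n` nodes. -/
noncomputable def scale (k n : ℕ) : ℝ := (n : ℝ) ^ (1 / (k : ℝ))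

lemma scale_nonneg (k n : ℕ) : 0 ≤ scale k n := by unfold scale; positivity

lemma scale_pos (k : ℕ) {n : ℕ} (hn : 0 < n) : 0 < scale k n := by unfold scale; positivity

lemma scale_pow {k : ℕ} (hk : k ≠ 0) (n : ℕ) : scale k n ^ k = n := by
  rw [scale, one_div, Real.rpow_inv_natCast_pow n.cast_nonneg hk]

lemma tendsto_scale {k : ℕ} (hk : k ≠ 0) : Tendsto (scale k) atTop atTop :=
  (tendsto_rpow_atTop (by positivity)).comp tendsto_natCast_atTop_atTop

lemma tendsto_div_scale {k : ℕ} (hk : k ≠ 0) (s : ℝ) :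
    Tendsto (fun n => s / scale k n) atTop (𝓝 0) :=
  (tendsto_scale hk).const_div_atTop s

lemma mul_div_scale_pow {k : ℕ} (hk : k ≠ 0) {n : ℕ} (hn : 0 < n) (s : ℝ) :
    (n : ℝ) * (s / scale k n) ^ k = s ^ k := by
  rw [div_pow, scale_pow hk, mul_div_cancel₀ _ (by positivity)]

lemma tendsto_mul_one_sub_erlangTail {k : ℕ} (hk : k ≠ 0) {s : ℝ} (hs : 0 ≤ s) :
    Tendsto (fun n : ℕ => (n : ℝ) * (1 - erlangTail k (s / scale k n))) atTop
      (𝓝 (s ^ k / k.factorial)) := by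
  have hlower : Tendsto (fun n : ℕ => Real.exp (-(s / scale k n)) * (s ^ k / k.factorial)) atTop
      (𝓝 (s ^ k / k.factorial)) := by
    simpa using ((tendsto_div_scale hk s).neg.rexp).mul_const (s ^ k / (k.factorial : ℝ))
  refine tendsto_of_tendsto_of_tendsto_of_le_of_le' hlower tendsto_const_nhds ?_ ?_ <;>
    filter_upwards [eventually_gt_atTop 0] with n hn
  · calc Real.exp (-(s / scale k n)) * (s ^ k / k.factorial)
        = n * (Real.exp (-(s / scale k n)) * ((s / scale k n) ^ k / k.factorial)) := by
          rw [← mul_div_scale_pow hk hn s]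
          ring
      _ ≤ _ := by
          gcongr
          exact le_one_sub_erlangTail k (div_nonneg hs (scale_nonneg k n))
  · rw [← mul_div_scale_pow hk hn s, mul_div_assoc]
    gcongr
    exact one_sub_erlangTail_le k (div_nonneg hs (scale_nonneg k n))

lemma tendsto_erlangTail_zero {r : ℕ} (hr : r ≠ 0) : Tendsto (erlangTail r) (𝓝 0) (𝓝 1) := by
  have hlower : Tendsto (fun x : ℝ => 1 - |x| ^ r / r.factorial) (𝓝 0) (𝓝 1) := by
    have hcont : Continuous fun x : ℝ => 1 - |x| ^ r / r.factorial := by fun_prop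
    simpa [hr] using hcont.tendsto 0
  refine tendsto_of_tendsto_of_tendsto_of_le_of_le hlower tendsto_const_nhds (fun x => ?_)
    (erlangTail_le_one r)
  calc 1 - |x| ^ r / r.factorial ≤ erlangTail r |x| := by
        linarith [one_sub_erlangTail_le r (abs_nonneg x)]
    _ ≤ erlangTail r x := antitone_erlangTail r (le_abs_self x)

lemma recordDensity_nonneg (k n : ℕ) (x : ℝ) : 0 ≤ recordDensity k n x :=
  mul_nonneg (Real.exp_pos _).le <|
    Finset.sum_nonneg fun _ _ => pow_nonneg (erlangTail_nonneg _ _) _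

@[fun_prop]
lemma measurable_recordDensity (k n : ℕ) : Measurable (recordDensity k n) := by
  unfold recordDensity
  fun_prop

lemma tendsto_recordDensity {k : ℕ} (hk : k ≠ 0) {s : ℝ} (hs : 0 < s) :
    Tendsto (fun n : ℕ => (n : ℝ)⁻¹ * recordDensity k n (s / scale k n)) atTop
      (𝓝 (expMoment 0 (s ^ k / k.factorial))) := by
  have hmean := tendsto_geom_mean (by positivity) (tendsto_mul_one_sub_erlangTail hk hs.le)
  simpa [recordDensity, mul_left_comm] using (tendsto_div_scale hk s).neg.rexp.mul hmean

lemma recordDensity_le {n : ℕ} (k : ℕ) {x : ℝ} (hx : 0 ≤ x) : recordDensity k n x ≤ n := by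
  have hsum : ∑ v ∈ Finset.range n, erlangTail k x ^ v ≤ n := by
    simpa using Finset.sum_le_card_nsmul (Finset.range n) _ 1
      fun v _ => (erlangTail_pow_mem_Icc k v x).2
  exact (mul_le_of_le_one_left (Finset.sum_nonneg fun v _ => (erlangTail_pow_mem_Icc k v x).1)
    (Real.exp_le_one_iff.2 (neg_nonpos.2 hx))).trans hsum

lemma pow_mul_recordDensity_le (k n : ℕ) {x : ℝ} (hx : 0 ≤ x) :
    x ^ k * recordDensity k n x ≤ k.factorial := by
  have hgeom : (1 - erlangTail k x) * ∑ v ∈ Finset.range n, erlangTail k x ^ v ≤ 1 := by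
    rw [mul_neg_geom_sum]
    linarith [(erlangTail_pow_mem_Icc k n x).1]
  calc x ^ k * recordDensity k n x
      = k.factorial * (Real.exp (-x) * (x ^ k / k.factorial) *
          ∑ v ∈ Finset.range n, erlangTail k x ^ v) := by
        rw [recordDensity]
        field_simp
    _ ≤ k.factorial * ((1 - erlangTail k x) * ∑ v ∈ Finset.range n, erlangTail k x ^ v) := by
        gcongr
        · exact Finset.sum_nonneg fun v _ => (erlangTail_pow_mem_Icc k v x).1
        · exact le_one_sub_erlangTail k hx
    _ ≤ k.factorial := mul_le_of_le_one_right (Nat.cast_nonneg _) hgeom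

/-- An integrable bound, uniform in `n`, for the rescaled intensity of the records. -/
noncomputable def scaleBound (k : ℕ) (s : ℝ) : ℝ := 2 * k.factorial * (1 + s ^ 2)⁻¹

lemma integrable_scaleBound (k : ℕ) : Integrable (scaleBound k) :=
  integrable_inv_one_add_sq.const_mul _

lemma scaleBound_nonneg (k : ℕ) (s : ℝ) : 0 ≤ scaleBound k s := by unfold scaleBound; positivity

lemma inv_mul_recordDensity_le_scaleBound {k : ℕ} (hk : 2 ≤ k) (n : ℕ) {s : ℝ} (hs : 0 < s) :
    (n : ℝ)⁻¹ * recordDensity k n (s / scale k n) ≤ scaleBound k s := by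
  rcases Nat.eq_zero_or_pos n with rfl | hn
  · simpa using scaleBound_nonneg k s
  have hx : 0 ≤ s / scale k n := div_nonneg hs.le (scale_nonneg k n)
  set D := (n : ℝ)⁻¹ * recordDensity k n (s / scale k n) with hD
  have hD0 : 0 ≤ D := mul_nonneg (by positivity) (recordDensity_nonneg _ _ _)
  have hone : D ≤ k.factorial :=
    calc D ≤ 1 := inv_mul_le_one_of_le₀ (recordDensity_le k hx) (by positivity)
      _ ≤ k.factorial := by exact_mod_cast k.factorial_pos
  have hpow : D * s ^ k ≤ k.factorial := by
    refine le_of_eq_of_le ?_ (pow_mul_recordDensity_le k n hx)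
    rw [hD, ← mul_div_scale_pow (by omega) hn s]
    field_simp
  have hsq : D * s ^ 2 ≤ k.factorial := by
    rcases le_total s 1 with hs1 | hs1
    · exact (mul_le_of_le_one_right hD0 (pow_le_one₀ hs.le hs1)).trans hone
    · exact (mul_le_mul_of_nonneg_left (pow_le_pow_right₀ hs1 hk) hD0).trans hpow
  rw [scaleBound, ← div_eq_mul_inv, le_div_iff₀ (by positivity)]
  linarith

lemma tendsto_integral_recordDensity {k : ℕ} (hk : 2 ≤ k) :
    Tendsto (fun n : ℕ => scale k n / n * ∫ x in Ioi 0, recordDensity k n x) atTop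
      (𝓝 (∫ s in Ioi 0, expMoment 0 (s ^ k / k.factorial))) := by
  have hlim : Tendsto (fun n : ℕ =>
      ∫ s in Ioi (0 : ℝ), (n : ℝ)⁻¹ * recordDensity k n (s / scale k n)) atTop
      (𝓝 (∫ s in Ioi 0, expMoment 0 (s ^ k / k.factorial))) := by
    refine tendsto_integral_of_dominated_convergence (scaleBound k)
      (fun n => Measurable.aestronglyMeasurable (by fun_prop))
      (integrable_scaleBound k).integrableOn
      (fun n => ae_restrict_of_forall_mem measurableSet_Ioi fun s hs => ?_)
      (ae_restrict_of_forall_mem measurableSet_Ioi fun s hs => tendsto_recordDensity (by omega) hs)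
    rw [Real.norm_of_nonneg (mul_nonneg (by positivity) (recordDensity_nonneg _ _ _))]
    exact inv_mul_recordDensity_le_scaleBound hk n hs
  refine hlim.congr' ?_
  filter_upwards [eventually_gt_atTop 0] with n hn
  have hchange := integral_comp_mul_left_Ioi (recordDensity k n) 0 (inv_pos.2 (scale_pos k hn))
  simp only [mul_zero, inv_inv, smul_eq_mul, ← div_eq_inv_mul] at hchange
  rw [integral_const_mul, hchange]
  ring

lemma recordPairDensity_nonneg (k n : ℕ) (z : ℝ × ℝ) : 0 ≤ recordPairDensity k n z :=
  mul_nonneg (by positivity) <| mul_nonneg (erlangTail_nonneg _ _) <|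
    pairSum_nonneg n (erlangTail_nonneg _ _) (erlangTail_nonneg _ _)

@[fun_prop]
lemma measurable_recordPairDensity (k n : ℕ) : Measurable (recordPairDensity k n) := by
  unfold recordPairDensity pairSum
  fun_prop

lemma recordPairDensity_le (k n : ℕ) (z : ℝ × ℝ) :
    recordPairDensity k n z ≤ recordDensity k n z.1 * recordDensity k n z.2 := by
  have hsum_nonneg : ∀ x, 0 ≤ ∑ v ∈ Finset.range n, erlangTail k x ^ v := fun x =>
    Finset.sum_nonneg fun v _ => (erlangTail_pow_mem_Icc k v x).1
  have hpair : pairSum n (erlangTail k (max z.1 z.2)) (erlangTail k z.2) ≤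
      (∑ v ∈ Finset.range n, erlangTail k z.1 ^ v) *
        ∑ v ∈ Finset.range n, erlangTail k z.2 ^ v := by
    refine (pairSum_le n (erlangTail_nonneg _ _) (erlangTail_nonneg _ _)).trans
      (mul_le_mul_of_nonneg_right (Finset.sum_le_sum fun v _ => ?_) (hsum_nonneg _))
    exact pow_le_pow_left₀ (erlangTail_nonneg _ _) (antitone_erlangTail k (le_max_left _ _)) v
  calc recordPairDensity k n z
      ≤ Real.exp (-z.1) * Real.exp (-z.2) * (1 * ((∑ v ∈ Finset.range n, erlangTail k z.1 ^ v) *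
        ∑ v ∈ Finset.range n, erlangTail k z.2 ^ v)) := by
        rw [recordPairDensity]
        gcongr
        · exact pairSum_nonneg n (erlangTail_nonneg _ _) (erlangTail_nonneg _ _)
        · exact erlangTail_le_one _ _
    _ = recordDensity k n z.1 * recordDensity k n z.2 := by
        rw [recordDensity, recordDensity]
        ring

/-- The limit of the rescaled intensity `n⁻² * recordPairDensity k n (z / n ^ (1 / k))` of the pairs
of records. -/
noncomputable def pairDensity (k : ℕ) (z : ℝ × ℝ) : ℝ :=
  expPairMean (max z.1 z.2 ^ k / k.factorial) (z.2 ^ k / k.factorial)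

lemma continuous_pairDensity (k : ℕ) : Continuous (pairDensity k) := by
  unfold pairDensity expPairMean
  exact intervalIntegral.continuous_parametric_intervalIntegral_of_continuous' (by fun_prop) 0 1

lemma pairDensity_nonneg (k : ℕ) (z : ℝ × ℝ) : 0 ≤ pairDensity k z :=
  intervalIntegral.integral_nonneg zero_le_one fun _ _ => expMoment_nonneg _ _

lemma tendsto_recordPairDensity {k : ℕ} (hk : 2 ≤ k) {z : ℝ × ℝ} (hz : z ∈ quadrant) :
    Tendsto (fun n : ℕ => ((n : ℝ) ^ 2)⁻¹ * recordPairDensity k n ((scale k n)⁻¹ • z)) atTop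
      (𝓝 (pairDensity k z)) := by
  obtain ⟨hz1 : 0 < z.1, hz2 : 0 < z.2⟩ := hz
  have hk0 : k ≠ 0 := by omega
  have hm : 0 < max z.1 z.2 := lt_max_of_lt_left hz1
  have hpair := tendsto_pairSum (σ := max z.1 z.2 ^ k / k.factorial) (τ := z.2 ^ k / k.factorial)
    (p := fun n => erlangTail k (max z.1 z.2 / scale k n))
    (q := fun n => erlangTail k (z.2 / scale k n)) (by positivity) (by positivity)
    (fun h => by
      rw [div_left_inj' (by positivity), pow_left_inj₀ hm.le hz2.le hk0] at h
      rw [h])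
    (tendsto_mul_one_sub_erlangTail hk0 hm.le) (tendsto_mul_one_sub_erlangTail hk0 hz2.le)
  have htail := (tendsto_erlangTail_zero (r := k - 1) (by omega)).comp
    (tendsto_div_scale hk0 (z.2 - z.1))
  have hlim := ((tendsto_div_scale hk0 z.1).neg.rexp.mul
    (tendsto_div_scale hk0 z.2).neg.rexp).mul (htail.mul hpair)
  simp only [neg_zero, Real.exp_zero, one_mul] at hlim
  refine hlim.congr fun n => ?_
  simp only [recordPairDensity, Function.comp_apply, Prod.smul_fst, Prod.smul_snd, smul_eq_mul,
    ← div_eq_inv_mul, max_div_div_right (scale_nonneg k n), ← sub_div]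
  ring

lemma recordPairDensity_le_scaleBound {k : ℕ} (hk : 2 ≤ k) (n : ℕ) {z : ℝ × ℝ}
    (hz : z ∈ quadrant) :
    ((n : ℝ) ^ 2)⁻¹ * recordPairDensity k n ((scale k n)⁻¹ • z) ≤
      scaleBound k z.1 * scaleBound k z.2 :=
  calc ((n : ℝ) ^ 2)⁻¹ * recordPairDensity k n ((scale k n)⁻¹ • z)
      ≤ ((n : ℝ) ^ 2)⁻¹ *
        (recordDensity k n (z.1 / scale k n) * recordDensity k n (z.2 / scale k n)) := by
        gcongr
        simpa [← div_eq_inv_mul] using recordPairDensity_le k n ((scale k n)⁻¹ • z)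
    _ = (n : ℝ)⁻¹ * recordDensity k n (z.1 / scale k n) *
        ((n : ℝ)⁻¹ * recordDensity k n (z.2 / scale k n)) := by ring
    _ ≤ scaleBound k z.1 * scaleBound k z.2 :=
        mul_le_mul (inv_mul_recordDensity_le_scaleBound hk n hz.1)
          (inv_mul_recordDensity_le_scaleBound hk n hz.2)
          (mul_nonneg (by positivity) (recordDensity_nonneg _ _ _)) (scaleBound_nonneg _ _)

lemma integrableOn_scaleBound_mul (k : ℕ) :
    IntegrableOn (fun z : ℝ × ℝ => scaleBound k z.1 * scaleBound k z.2) quadrant :=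
  ((integrable_scaleBound k).mul_prod (integrable_scaleBound k)).integrableOn

lemma integrableOn_pairDensity {k : ℕ} (hk : 2 ≤ k) : IntegrableOn (pairDensity k) quadrant := by
  refine (integrableOn_scaleBound_mul k).mono' (continuous_pairDensity k).aestronglyMeasurable
    (ae_restrict_of_forall_mem measurableSet_quadrant fun z hz => ?_)
  rw [Real.norm_of_nonneg (pairDensity_nonneg k z)]
  exact le_of_tendsto' (tendsto_recordPairDensity hk hz) fun n =>
    recordPairDensity_le_scaleBound hk n hz

lemma setIntegral_quadrant_comp_inv_smul (f : ℝ × ℝ → ℝ) {c : ℝ} (hc : 0 < c) :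
    ∫ z in quadrant, f (c⁻¹ • z) = c ^ 2 * ∫ z in quadrant, f z := by
  have hset : c⁻¹ • quadrant = quadrant := by
    ext z
    rw [mem_smul_set_iff_inv_smul_mem₀ (inv_pos.2 hc).ne']
    simp [hc]
  rw [Measure.setIntegral_comp_smul_of_pos _ _ _ (inv_pos.2 hc), hset]
  simp

lemma tendsto_integral_recordPairDensity {k : ℕ} (hk : 2 ≤ k) :
    Tendsto (fun n : ℕ => (scale k n / n) ^ 2 * ∫ z in quadrant, recordPairDensity k n z) atTop
      (𝓝 (∫ z in quadrant, pairDensity k z)) := by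
  have hlim : Tendsto (fun n : ℕ => ∫ z in quadrant,
      ((n : ℝ) ^ 2)⁻¹ * recordPairDensity k n ((scale k n)⁻¹ • z)) atTop
      (𝓝 (∫ z in quadrant, pairDensity k z)) := by
    refine tendsto_integral_of_dominated_convergence
      (fun z => scaleBound k z.1 * scaleBound k z.2)
      (fun n => Measurable.aestronglyMeasurable (by fun_prop)) (integrableOn_scaleBound_mul k)
      (fun n => ae_restrict_of_forall_mem measurableSet_quadrant fun z hz => ?_)
      (ae_restrict_of_forall_mem measurableSet_quadrant fun z hz => tendsto_recordPairDensity hk hz)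
    rw [Real.norm_of_nonneg (mul_nonneg (by positivity) (recordPairDensity_nonneg _ _ _))]
    exact recordPairDensity_le_scaleBound hk n hz
  refine hlim.congr' ?_
  filter_upwards [eventually_gt_atTop 0] with n hn
  rw [integral_const_mul, setIntegral_quadrant_comp_inv_smul _ (scale_pos k hn)]
  ring

end Scaling

section Series

lemma hasSum_cot {x : ℝ} (hx : (x : ℂ) ∈ Complex.integerComplement) :
    HasSum (fun j : ℕ => 1 / (x - (j + 1)) + 1 / (x + (j + 1)))
      (Real.pi * Real.cot (Real.pi * x) - 1 / x) := by
  rw [← Complex.hasSum_ofReal]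
  convert! (summable_cotTerm hx).hasSum using 1
  · ext j
    simp [cotTerm]
  · rw [← cot_series_rep' hx]
    simp

lemma hasSum_one_div_add_sub_succ {x : ℝ} (hx : 0 < x) :
    HasSum (fun j : ℕ => 1 / (x + j) - 1 / (x + (j + 1))) (1 / x) := by
  rw [hasSum_iff_tendsto_nat_of_nonneg fun j => sub_nonneg.2 (by gcongr; linarith)]
  have hlim : Tendsto (fun n : ℕ => 1 / (x + n)) atTop (𝓝 0) :=
    (tendsto_atTop_add_const_left _ x tendsto_natCast_atTop_atTop).const_div_atTop 1
  refine (sub_zero (1 / x) ▸ hlim.const_sub (1 / x)).congr fun n => ?_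
  simpa using (Finset.sum_range_sub' (fun j : ℕ => 1 / (x + j)) n).symm

lemma hasSum_one_div_add_sub_one_div_sub {x : ℝ} (hx0 : 0 < x)
    (hx : (x : ℂ) ∈ Complex.integerComplement) :
    HasSum (fun j : ℕ => 1 / (x + j) - 1 / (j + 1 - x)) (Real.pi * Real.cot (Real.pi * x)) := by
  convert! (hasSum_cot hx).add (hasSum_one_div_add_sub_succ hx0) using 1
  · ext j
    rw [← neg_sub x, div_neg]
    ring
  · ring

lemma hasSum_one_div_odd_sq :
    HasSum (fun j : ℕ => 1 / (2 * (j : ℝ) + 1) ^ 2) (Real.pi ^ 2 / 8) := by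
  have heven : HasSum (fun j : ℕ => 1 / (((2 * j : ℕ) : ℝ)) ^ 2) (Real.pi ^ 2 / 24) := by
    convert! hasSum_zeta_two.mul_left (1 / 4) using 1
    · ext j
      push_cast
      ring
    · ring
  have hodd : Summable fun j : ℕ => 1 / (((2 * j + 1 : ℕ) : ℝ)) ^ 2 :=
    hasSum_zeta_two.summable.comp_injective (i := fun j : ℕ => 2 * j + 1)
      fun a b hab => by simpa using hab
  have hsplit := (heven.even_add_odd (f := fun n : ℕ => 1 / (n : ℝ) ^ 2) hodd.hasSum).unique
    hasSum_zeta_two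
  have hvalue : ∑' j : ℕ, 1 / (((2 * j + 1 : ℕ) : ℝ)) ^ 2 = Real.pi ^ 2 / 8 := by linarith
  convert! hodd.hasSum using 2
  · push_cast
    rfl
  · exact hvalue.symm

/-- The terms of the series `∑ j, 1 / ((k j + 1) (k j + k - 1))`, through which the pairs of records
that appear out of time order enter the constant `gam k`. -/
noncomputable def crossTerm (k j : ℕ) : ℝ := 1 / (((k : ℝ) * j + 1) * (k * j + k - 1))

lemma crossTerm_nonneg {k : ℕ} (hk : 1 ≤ k) (j : ℕ) : 0 ≤ crossTerm k j := by
  have hk' : (1 : ℝ) ≤ k := by exact_mod_cast hk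
  have hkj : (0 : ℝ) ≤ k * j := by positivity
  exact one_div_nonneg.2 (mul_nonneg (by positivity) (by linarith))

lemma hasSum_crossTerm_two : HasSum (crossTerm 2) (Real.pi ^ 2 / 8) := by
  convert! hasSum_one_div_odd_sq using 2 with j
  rw [crossTerm]
  push_cast
  ring

lemma hasSum_crossTerm {k : ℕ} (hk : 2 < k) :
    HasSum (crossTerm k) (Real.pi * Real.cot (Real.pi / k) / (k * (k - 2))) := by
  have hk' : (2 : ℝ) < k := by exact_mod_cast hk
  have hmem : ((1 / k : ℝ) : ℂ) ∈ Complex.integerComplement := by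
    rintro ⟨m, hm⟩
    have hm' : (m : ℝ) = 1 / k := by exact_mod_cast hm
    have hpos : (0 : ℝ) < m := by rw [hm']; positivity
    have hlt : (m : ℝ) < 1 := by rw [hm', div_lt_one (by linarith)]; linarith
    norm_cast at hpos hlt
    omega
  have hcot := (hasSum_one_div_add_sub_one_div_sub (by positivity) hmem).div_const
    ((k : ℝ) * (k - 2))
  rw [mul_one_div] at hcot
  refine hcot.congr_fun fun j => ?_
  have hkj : (0 : ℝ) ≤ k * j := by positivity
  have hne2 : (k : ℝ) - 2 ≠ 0 := by linarith
  have hne1 : (k : ℝ) * (j + 1) - 1 ≠ 0 := by linarith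
  rw [crossTerm]
  field_simp
  ring

lemma summable_crossTerm {k : ℕ} (hk : 2 ≤ k) : Summable (crossTerm k) := by
  rcases hk.eq_or_lt with rfl | hk
  · exact hasSum_crossTerm_two.summable
  · exact (hasSum_crossTerm hk).summable

lemma gam_eq_tsum {k : ℕ} (hk : 2 ≤ k) :
    gam k = Real.Gamma (2 / k) * (k.factorial : ℝ) ^ (2 / (k : ℝ)) / (k - 1) *
      (1 + k * ∑' j, crossTerm k j) := by
  rcases hk.eq_or_lt with rfl | hk
  · rw [hasSum_crossTerm_two.tsum_eq, gam, lam, if_pos rfl]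
    norm_num
    ring
  · have hk' : (2 : ℝ) < k := by exact_mod_cast hk
    have hk1 : (k : ℝ) - 1 ≠ 0 := by linarith
    have hk2 : (k : ℝ) - 2 ≠ 0 := by linarith
    rw [(hasSum_crossTerm hk).tsum_eq, gam, lam, if_neg hk.ne']
    field_simp

end Series

section Evaluation

lemma setLIntegral_Ioc_ofReal {f : ℝ → ℝ} {a b : ℝ} (hab : a ≤ b)
    (hf : IntervalIntegrable f volume a b) (hf0 : ∀ x ∈ Ioc a b, 0 ≤ f x) :
    ∫⁻ x in Ioc a b, ENNReal.ofReal (f x) = ENNReal.ofReal (∫ x in a..b, f x) := by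
  rw [intervalIntegral.integral_of_le hab, ofReal_integral_eq_lintegral_ofReal
    ((intervalIntegrable_iff_integrableOn_Ioc_of_le hab).1 hf)
    (ae_restrict_of_forall_mem measurableSet_Ioc hf0)]

lemma lintegral_rpow_mul_exp_neg_mul {a r : ℝ} (ha : 0 < a) (hr : 0 < r) :
    ∫⁻ x in Ioi 0, ENNReal.ofReal (x ^ (a - 1) * Real.exp (-(r * x))) =
      ENNReal.ofReal ((1 / r) ^ a * Real.Gamma a) := by
  have hint : IntegrableOn (fun x => x ^ (a - 1) * Real.exp (-(r * x))) (Ioi 0) := by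
    simpa [neg_mul] using
      integrableOn_rpow_mul_exp_neg_mul_rpow (s := a - 1) (p := 1) (by linarith) one_pos hr
  rw [← Real.integral_rpow_mul_exp_neg_mul_Ioi ha hr, ofReal_integral_eq_lintegral_ofReal hint
    (ae_restrict_of_forall_mem measurableSet_Ioi fun x hx =>
      mul_nonneg (Real.rpow_nonneg (le_of_lt hx) _) (Real.exp_pos _).le)]

lemma lintegral_rpow_mul_expMoment {a : ℝ} {i : ℕ} (ha : 0 < a) (hai : a < i + 1) :
    ∫⁻ x in Ioi 0, ENNReal.ofReal (x ^ (a - 1) * expMoment i x) =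
      ENNReal.ofReal (Real.Gamma a / (i + 1 - a)) := by
  have hexpand : ∀ x ∈ Ioi (0 : ℝ), ENNReal.ofReal (x ^ (a - 1) * expMoment i x) =
      ∫⁻ ρ in Ioc (0 : ℝ) 1, ENNReal.ofReal (ρ ^ i * (x ^ (a - 1) * Real.exp (-(ρ * x)))) := by
    intro x (hx : 0 < x)
    rw [expMoment, ← intervalIntegral.integral_const_mul,
      ← setLIntegral_Ioc_ofReal zero_le_one (Continuous.intervalIntegrable (by fun_prop) _ _)]
    · simp only [mul_left_comm]
    · intro ρ hρ
      have := hρ.1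
      positivity
  have hinner : ∀ ρ ∈ Ioc (0 : ℝ) 1,
      ∫⁻ x in Ioi 0, ENNReal.ofReal (ρ ^ i * (x ^ (a - 1) * Real.exp (-(ρ * x)))) =
        ENNReal.ofReal (Real.Gamma a * ρ ^ (i - a)) := by
    intro ρ ⟨hρ, _⟩
    simp only [ENNReal.ofReal_mul (pow_nonneg hρ.le i)]
    rw [lintegral_const_mul' _ _ ENNReal.ofReal_ne_top, lintegral_rpow_mul_exp_neg_mul ha hρ,
      ← ENNReal.ofReal_mul (by positivity), Real.rpow_sub hρ, Real.rpow_natCast, one_div,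
      Real.inv_rpow hρ.le]
    congr 1
    ring
  rw [setLIntegral_congr_fun measurableSet_Ioi hexpand, lintegral_lintegral_swap (by fun_prop),
    setLIntegral_congr_fun measurableSet_Ioc hinner,
    setLIntegral_Ioc_ofReal zero_le_one
      ((intervalIntegral.intervalIntegrable_rpow' (by linarith)).const_mul _),
    intervalIntegral.integral_const_mul, integral_rpow (Or.inl (by linarith))]
  · rw [Real.zero_rpow (by linarith), Real.one_rpow]
    ring_nf
  · intro ρ hρ
    have := hρ.1
    have := Real.Gamma_pos_of_pos ha
    positivity

lemma lintegral_pow_mul_comp_pow_div {k : ℕ} (hk : k ≠ 0) (m : ℕ) {c : ℝ} (hc : 0 < c)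
    (f : ℝ → ℝ) :
    ∫⁻ s in Ioi 0, ENNReal.ofReal (s ^ m * f (s ^ k / c)) =
      ENNReal.ofReal (c ^ ((m + 1) / k : ℝ) / k) *
        ∫⁻ x in Ioi 0, ENNReal.ofReal (x ^ ((m + 1) / k - 1 : ℝ) * f x) := by
  have himage : (fun s : ℝ => s ^ k / c) '' Ioi 0 = Ioi 0 := by
    ext x
    refine ⟨?_, fun hx => ?_⟩
    · rintro ⟨s, hs : 0 < s, rfl⟩
      exact div_pos (pow_pos hs k) hc
    · have hx : 0 < x := hx
      refine ⟨(c * x) ^ (k : ℝ)⁻¹, Real.rpow_pos_of_pos (by positivity) _, ?_⟩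
      simp only [Real.rpow_inv_natCast_pow (show 0 ≤ c * x by positivity) hk]
      field_simp
  have hchange := lintegral_image_eq_lintegral_abs_deriv_mul (s := Ioi (0 : ℝ))
    (f := fun s => s ^ k / c) (f' := fun s => k * s ^ (k - 1) / c) measurableSet_Ioi
    (fun s _ => ((hasDerivAt_pow k s).div_const c).hasDerivWithinAt)
    (fun s (hs : 0 < s) t (ht : 0 < t) h => (pow_left_inj₀ hs.le ht.le hk).1
      ((div_left_inj' hc.ne').1 h))
    (fun x => ENNReal.ofReal (x ^ ((m + 1) / k - 1 : ℝ) * f x))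
  rw [himage] at hchange
  rw [hchange, ← lintegral_const_mul' _ _ ENNReal.ofReal_ne_top]
  refine setLIntegral_congr_fun measurableSet_Ioi fun s (hs : 0 < s) => ?_
  rw [← ENNReal.ofReal_mul (by positivity), ← ENNReal.ofReal_mul (by positivity)]
  have hpow : (s ^ k / c) ^ ((m + 1) / k - 1 : ℝ) =
      s ^ (m + 1) / s ^ k * c / c ^ ((m + 1) / k : ℝ) := by
    rw [Real.rpow_sub_one (by positivity), Real.div_rpow (by positivity) hc.le,
      ← Real.rpow_natCast s k, ← Real.rpow_mul hs.le, mul_div_cancel₀ _ (by positivity),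
      ← Nat.cast_add_one, Real.rpow_natCast, Real.rpow_natCast]
    field_simp
  congr 1
  rw [hpow, abs_of_pos (by positivity), pow_succ s m, ← pow_sub_one_mul hk s]
  field_simp

lemma integral_expMoment_zero {k : ℕ} (hk : 2 ≤ k) :
    ∫ s in Ioi 0, expMoment 0 (s ^ k / k.factorial) = eta k 1 := by
  have hk' : (2 : ℝ) ≤ k := by exact_mod_cast hk
  have hlintegral := lintegral_pow_mul_comp_pow_div (k := k) (by omega) 0
    (Nat.cast_pos.2 k.factorial_pos) (expMoment 0)
  simp only [pow_zero, one_mul, Nat.cast_zero, zero_add] at hlintegral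
  have hGamma : 0 < Real.Gamma (1 / k) := Real.Gamma_pos_of_pos (by positivity)
  have hlt : 1 / (k : ℝ) < 1 := by rw [div_lt_one (by linarith)]; linarith
  rw [integral_eq_lintegral_of_nonneg_ae (ae_of_all _ fun _ => expMoment_nonneg _ _)
    (Continuous.aestronglyMeasurable (by fun_prop)), hlintegral,
    lintegral_rpow_mul_expMoment (by positivity)
      (by simpa using hlt),
    ← ENNReal.ofReal_mul (by positivity), ENNReal.toReal_ofReal, eta]
  · have : (k : ℝ) - 1 ≠ 0 := by linarith
    simp only [Nat.cast_zero, zero_add, Nat.cast_one, Real.Gamma_one]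
    field_simp
  · exact mul_nonneg (by positivity) (div_nonneg hGamma.le (by simpa using hlt.le))

/-- Half of the contribution to `gam k` of the pairs of records appearing in order of time. -/
noncomputable def orderedConst (k : ℕ) : ℝ :=
  (k.factorial : ℝ) ^ (2 / (k : ℝ)) * Real.Gamma (2 / k) / (2 * (k - 1))

lemma orderedConst_nonneg {k : ℕ} (hk : 1 ≤ k) : 0 ≤ orderedConst k := by
  have hk' : (1 : ℝ) ≤ k := by exact_mod_cast hk
  have := Real.Gamma_nonneg_of_nonneg (s := 2 / k) (by positivity)
  exact div_nonneg (by positivity) (by linarith)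

lemma lintegral_mul_expMoment_one {k : ℕ} (hk : 2 ≤ k) :
    ∫⁻ t in Ioi 0, ENNReal.ofReal (t * expMoment 1 (t ^ k / k.factorial)) =
      ENNReal.ofReal (orderedConst k) := by
  have hk' : (2 : ℝ) ≤ k := by exact_mod_cast hk
  have hlintegral := lintegral_pow_mul_comp_pow_div (k := k) (by omega) 1
    (Nat.cast_pos.2 k.factorial_pos) (expMoment 1)
  simp only [pow_one, Nat.cast_one, one_add_one_eq_two] at hlintegral
  rw [hlintegral, lintegral_rpow_mul_expMoment (by positivity)
      (by rw [div_lt_iff₀ (by linarith)]; push_cast; linarith),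
    ← ENNReal.ofReal_mul (by positivity), orderedConst]
  have : (k : ℝ) - 1 ≠ 0 := by linarith
  have hexponent : ((1 : ℕ) : ℝ) + 1 - 2 / k = 2 * (k - 1) / k := by
    field_simp
    push_cast
    ring
  rw [hexponent]
  congr 1
  field_simp

lemma gam_eq_two_mul_orderedConst {k : ℕ} (hk : 2 ≤ k) :
    gam k = 2 * (orderedConst k + k * (∑' j, crossTerm k j) * orderedConst k) := by
  have hk' : (2 : ℝ) ≤ k := by exact_mod_cast hk
  have : (k : ℝ) - 1 ≠ 0 := by linarith
  rw [gam_eq_tsum hk, orderedConst]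
  field_simp

lemma sub_mul_pairDensity {k : ℕ} {z : ℝ × ℝ} (h : z.2 ≤ z.1) :
    (z.1 ^ k - z.2 ^ k) * pairDensity k z =
      ∫ y in z.2..z.1, k * y ^ (k - 1) * expMoment 1 (y ^ k / k.factorial) := by
  have hsub := intervalIntegral.integral_comp_mul_deriv (a := z.2) (b := z.1)
    (f := fun y => y ^ k / k.factorial) (f' := fun y => k * y ^ (k - 1) / k.factorial)
    (g := expMoment 1) (fun y _ => (hasDerivAt_pow k y).div_const _) (by fun_prop) (by fun_prop)
  simp only [Function.comp_apply, ← sub_mul_expPairMean] at hsub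
  calc (z.1 ^ k - z.2 ^ k) * pairDensity k z
      = k.factorial * ((z.1 ^ k / k.factorial - z.2 ^ k / k.factorial) *
          expPairMean (z.1 ^ k / k.factorial) (z.2 ^ k / k.factorial)) := by
        rw [pairDensity, max_eq_left h]
        field_simp
    _ = _ := by
        rw [← hsub, ← intervalIntegral.integral_const_mul]
        refine intervalIntegral.integral_congr fun y _ => ?_
        field_simp

end Evaluation

section Lower

lemma setLIntegral_Ioc_pow (m : ℕ) {y : ℝ} (hy : 0 ≤ y) :
    ∫⁻ t in Ioc 0 y, ENNReal.ofReal (t ^ m) = ENNReal.ofReal (y ^ (m + 1) / (m + 1)) := by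
  rw [setLIntegral_Ioc_ofReal hy (Continuous.intervalIntegrable (by fun_prop) _ _)
    fun t ht => pow_nonneg ht.1.le m, integral_pow]
  simp

lemma setLIntegral_Ioi_inv_pow {m : ℕ} (hm : 1 < m) {y : ℝ} (hy : 0 < y) :
    ∫⁻ s in Ioi y, ENNReal.ofReal (s ^ m)⁻¹ = ENNReal.ofReal ((y ^ (m - 1))⁻¹ / (m - 1)) := by
  have hm' : -(m : ℝ) < -1 := by simpa using hm
  have hrpow : ∀ s ∈ Ioi y, ENNReal.ofReal (s ^ m)⁻¹ = ENNReal.ofReal (s ^ (-(m : ℝ))) :=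
    fun s hs => by rw [Real.rpow_neg (hy.trans hs).le, Real.rpow_natCast]
  rw [setLIntegral_congr_fun measurableSet_Ioi hrpow,
    ← ofReal_integral_eq_lintegral_ofReal (integrableOn_Ioi_rpow_of_lt hm' hy)
      (ae_restrict_of_forall_mem measurableSet_Ioi fun s hs =>
        Real.rpow_nonneg (hy.trans hs).le _),
    integral_Ioi_rpow_of_lt hm' hy, ← Real.rpow_natCast, ← Real.rpow_neg hy.le,
    Nat.cast_sub hm.le, Nat.cast_one, neg_sub, neg_add_eq_sub, ← neg_sub (m : ℝ) 1, neg_div_neg_eq]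

lemma hasSum_inv_pow_mul_pow {k : ℕ} (hk : k ≠ 0) {s t : ℝ} (ht : 0 ≤ t) (hts : t < s) :
    HasSum (fun j => (s ^ (k * (j + 1)))⁻¹ * t ^ (k * j)) (s ^ k - t ^ k)⁻¹ := by
  have hs : 0 < s := ht.trans_lt hts
  have hpow : t ^ k < s ^ k := pow_lt_pow_left₀ hts ht hk
  have hgeom := (hasSum_geometric_of_lt_one (r := t ^ k / s ^ k) (by positivity)
    ((div_lt_one (pow_pos hs k)).2 hpow)).mul_left (s ^ k)⁻¹
  convert! hgeom using 1
  · ext j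
    rw [div_pow, pow_mul, pow_mul, pow_succ]
    field_simp
  · rw [← mul_inv, mul_sub, mul_one, mul_div_cancel₀ _ (pow_pos hs k).ne']

lemma setLIntegral_prod_inv_pow_mul_pow {k : ℕ} (hk : 2 ≤ k) (j : ℕ) {y : ℝ} (hy : 0 < y) :
    ∫⁻ z in Ioi y ×ˢ Ioc 0 y, ENNReal.ofReal ((z.1 ^ (k * (j + 1)))⁻¹ * z.2 ^ (k * j)) =
      ENNReal.ofReal ((y ^ (k - 2))⁻¹ * crossTerm k j) := by
  have hkj : 1 < k * (j + 1) := hk.trans (Nat.le_mul_of_pos_right k j.succ_pos)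
  have hfactor : ∀ z ∈ Ioi y ×ˢ Ioc 0 y,
      ENNReal.ofReal ((z.1 ^ (k * (j + 1)))⁻¹ * z.2 ^ (k * j)) =
        ENNReal.ofReal (z.1 ^ (k * (j + 1)))⁻¹ * ENNReal.ofReal (z.2 ^ (k * j)) :=
    fun z hz => ENNReal.ofReal_mul (inv_nonneg.2 (pow_nonneg (hy.trans hz.1).le _))
  have hexponent : k * (j + 1) - 1 = k * j + 1 + (k - 2) := by
    rw [mul_add_one]
    omega
  have hden : ((k * (j + 1) : ℕ) : ℝ) - 1 = k * j + k - 1 := by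
    push_cast
    ring
  rw [setLIntegral_congr_fun (measurableSet_Ioi.prod measurableSet_Ioc) hfactor,
    Measure.volume_eq_prod, ← Measure.prod_restrict,
    lintegral_prod_mul (f := fun s => ENNReal.ofReal (s ^ (k * (j + 1)))⁻¹)
      (g := fun t => ENNReal.ofReal (t ^ (k * j))) (by fun_prop) (by fun_prop),
    setLIntegral_Ioi_inv_pow hkj hy,
    setLIntegral_Ioc_pow _ hy.le, ← ENNReal.ofReal_mul', hexponent, hden, pow_add, crossTerm]
  · push_cast
    field_simp
  · positivity

lemma setLIntegral_prod_inv_pow_sub_pow {k : ℕ} (hk : 2 ≤ k) {y : ℝ} (hy : 0 < y) :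
    ∫⁻ z in Ioi y ×ˢ Ioc 0 y, ENNReal.ofReal (z.1 ^ k - z.2 ^ k)⁻¹ =
      ENNReal.ofReal ((y ^ (k - 2))⁻¹ * ∑' j, crossTerm k j) := by
  have hnonneg : ∀ j, 0 ≤ (y ^ (k - 2))⁻¹ * crossTerm k j :=
    fun j => mul_nonneg (by positivity) (crossTerm_nonneg (by omega) j)
  have hexpand : ∀ z ∈ Ioi y ×ˢ Ioc 0 y, ENNReal.ofReal (z.1 ^ k - z.2 ^ k)⁻¹ =
      ∑' j, ENNReal.ofReal ((z.1 ^ (k * (j + 1)))⁻¹ * z.2 ^ (k * j)) := by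
    intro z hz
    have hz2 : 0 ≤ z.2 := hz.2.1.le
    have hz1 : 0 ≤ z.1 := (hy.trans hz.1).le
    have hsum := hasSum_inv_pow_mul_pow (k := k) (by omega) hz2 (hz.2.2.trans_lt hz.1)
    rw [← hsum.tsum_eq, ENNReal.ofReal_tsum_of_nonneg (fun j => by positivity) hsum.summable]
  rw [setLIntegral_congr_fun (measurableSet_Ioi.prod measurableSet_Ioc) hexpand,
    lintegral_tsum fun j => by fun_prop]
  simp only [setLIntegral_prod_inv_pow_mul_pow hk _ hy]
  rw [← ENNReal.ofReal_tsum_of_nonneg hnonneg ((summable_crossTerm hk).mul_left _), tsum_mul_left]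

lemma setLIntegral_prod_inv_pow_sub_pow_mul {k : ℕ} (hk : 2 ≤ k) {y : ℝ} (hy : 0 < y) (c : ℝ) :
    ∫⁻ z in Ioi y ×ˢ Ioc 0 y,
        ENNReal.ofReal (z.1 ^ k - z.2 ^ k)⁻¹ * ENNReal.ofReal (k * y ^ (k - 1) * c) =
      ENNReal.ofReal (k * ∑' j, crossTerm k j) * ENNReal.ofReal (y * c) := by
  have hsum : 0 ≤ ∑' j, crossTerm k j := tsum_nonneg fun j => crossTerm_nonneg (by omega) j
  have hpow : y ^ (k - 1) = y ^ (k - 2) * y := by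
    rw [← pow_succ]
    congr 1
    omega
  rw [lintegral_mul_const' _ _ ENNReal.ofReal_ne_top, setLIntegral_prod_inv_pow_sub_pow hk hy,
    ← ENNReal.ofReal_mul (by positivity), ← ENNReal.ofReal_mul (by positivity), hpow]
  congr 1
  field_simp

lemma ofReal_pairDensity {k : ℕ} (hk : k ≠ 0) {z : ℝ × ℝ} (hz : 0 ≤ z.2) (h : z.2 < z.1) :
    ENNReal.ofReal (pairDensity k z) = ∫⁻ y in Ico z.2 z.1, ENNReal.ofReal (z.1 ^ k - z.2 ^ k)⁻¹ *
      ENNReal.ofReal (k * y ^ (k - 1) * expMoment 1 (y ^ k / k.factorial)) := by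
  have hsub : 0 < z.1 ^ k - z.2 ^ k := sub_pos.2 (pow_lt_pow_left₀ h hz hk)
  rw [restrict_Ico_eq_restrict_Ioc, lintegral_const_mul' _ _ ENNReal.ofReal_ne_top,
    setLIntegral_Ioc_ofReal h.le (Continuous.intervalIntegrable (by fun_prop) _ _),
    ← sub_mul_pairDensity h.le, ← ENNReal.ofReal_mul (inv_nonneg.2 hsub.le),
    inv_mul_cancel_left₀ hsub.ne']
  intro y hy
  have := expMoment_nonneg 1 (y ^ k / k.factorial)
  have := hz.trans hy.1.le
  positivity

lemma measurableSet_snd_lt_fst : MeasurableSet {z : ℝ × ℝ | z.2 < z.1} :=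
  measurableSet_lt measurable_snd measurable_fst

lemma setLIntegral_quadrant_Ico_swap {F : ℝ × ℝ → ℝ → ℝ≥0∞}
    (hF : Measurable (Function.uncurry F)) :
    ∫⁻ z in quadrant, ∫⁻ y in Ico z.2 z.1, F z y =
      ∫⁻ y in Ioi 0, ∫⁻ z in Ioi y ×ˢ Ioc 0 y, F z y := by
  let A : Set ((ℝ × ℝ) × ℝ) := {p | p.2 ∈ Ico p.1.2 p.1.1}
  have hA : MeasurableSet A :=
    (measurableSet_le (measurable_snd.comp measurable_fst) measurable_snd).inter
      (measurableSet_lt measurable_snd (measurable_fst.comp measurable_fst))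
  have hIco : ∀ z ∈ quadrant, ∫⁻ y in Ico z.2 z.1, F z y =
      ∫⁻ y in Ioi 0, A.indicator (Function.uncurry F) (z, y) := by
    intro z hz
    have hinter : Ico z.2 z.1 ∩ Ioi 0 = Ico z.2 z.1 :=
      inter_eq_left.2 fun y hy => lt_of_lt_of_le hz.2 hy.1
    rw [← hinter, ← setLIntegral_indicator measurableSet_Ico]
    rfl
  have hprod : ∀ y ∈ Ioi (0 : ℝ), ∫⁻ z in quadrant, A.indicator (Function.uncurry F) (z, y) =
      ∫⁻ z in Ioi y ×ˢ Ioc 0 y, F z y := by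
    intro y hy
    have hinter : (Ioi y ×ˢ Iic y) ∩ quadrant = Ioi y ×ˢ Ioc 0 y := by
      rw [quadrant, prod_inter_prod, Ioi_inter_Ioi, max_eq_left (le_of_lt hy), Iic_inter_Ioi]
    rw [← hinter, ← setLIntegral_indicator (measurableSet_Ioi.prod measurableSet_Iic)]
    refine lintegral_congr fun z => ?_
    simp only [indicator_apply, mem_prod, mem_Ioi, mem_Iic, A, mem_ofPred_eq, mem_Ico, and_comm,
      Function.uncurry_apply_pair]
  rw [setLIntegral_congr_fun measurableSet_quadrant hIco, lintegral_lintegral_swap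
    (by exact (hF.indicator hA).aemeasurable), setLIntegral_congr_fun measurableSet_Ioi hprod]

lemma setLIntegral_pairDensity_lower {k : ℕ} (hk : 2 ≤ k) :
    ∫⁻ z in quadrant ∩ {z | z.2 < z.1}, ENNReal.ofReal (pairDensity k z) =
      ENNReal.ofReal (k * (∑' j, crossTerm k j) * orderedConst k) := by
  have hsum : 0 ≤ ∑' j, crossTerm k j := tsum_nonneg fun j => crossTerm_nonneg (by omega) j
  let w : ℝ → ℝ := fun y => k * y ^ (k - 1) * expMoment 1 (y ^ k / k.factorial)
  have hindicator : ∀ z ∈ quadrant,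
      {z : ℝ × ℝ | z.2 < z.1}.indicator (fun z => ENNReal.ofReal (pairDensity k z)) z =
        ∫⁻ y in Ico z.2 z.1, ENNReal.ofReal (z.1 ^ k - z.2 ^ k)⁻¹ * ENNReal.ofReal (w y) := by
    intro z hz
    by_cases h : z.2 < z.1
    · rw [indicator_of_mem (mem_ofPred_eq ▸ h), ofReal_pairDensity (by omega) (le_of_lt hz.2) h]
    · simp [h]
  calc ∫⁻ z in quadrant ∩ {z | z.2 < z.1}, ENNReal.ofReal (pairDensity k z)
      = ∫⁻ z in quadrant, ∫⁻ y in Ico z.2 z.1,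
          ENNReal.ofReal (z.1 ^ k - z.2 ^ k)⁻¹ * ENNReal.ofReal (w y) := by
        rw [← setLIntegral_congr_fun measurableSet_quadrant hindicator, inter_comm,
          setLIntegral_indicator measurableSet_snd_lt_fst]
    _ = ∫⁻ y in Ioi 0, ∫⁻ z in Ioi y ×ˢ Ioc 0 y,
          ENNReal.ofReal (z.1 ^ k - z.2 ^ k)⁻¹ * ENNReal.ofReal (w y) :=
        setLIntegral_quadrant_Ico_swap (by simp only [Function.uncurry_def, w]; fun_prop)
    _ = ENNReal.ofReal (k * (∑' j, crossTerm k j) * orderedConst k) := by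
        rw [setLIntegral_congr_fun measurableSet_Ioi fun y hy =>
            setLIntegral_prod_inv_pow_sub_pow_mul hk hy _,
          lintegral_const_mul' _ _ ENNReal.ofReal_ne_top, lintegral_mul_expMoment_one hk,
          ← ENNReal.ofReal_mul (by positivity)]

lemma setLIntegral_quadrant_sdiff {f : ℝ × ℝ → ℝ≥0∞} (hf : Measurable f) :
    ∫⁻ z in quadrant \ {z | z.2 < z.1}, f z = ∫⁻ t in Ioi 0, ∫⁻ s in Ioc 0 t, f (s, t) := by
  have hIoc : ∀ t : ℝ, ∫⁻ s in Ioc 0 t, f (s, t) =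
      ∫⁻ s in Ioi 0, {z : ℝ × ℝ | z.2 < z.1}ᶜ.indicator f (s, t) := by
    intro t
    rw [← Iic_inter_Ioi, ← setLIntegral_indicator measurableSet_Iic]
    refine lintegral_congr fun s => ?_
    simp [indicator_apply]
  simp only [hIoc]
  rw [sdiff_eq, inter_comm, ← setLIntegral_indicator measurableSet_snd_lt_fst.compl,
    Measure.volume_eq_prod, quadrant, ← Measure.prod_restrict,
    lintegral_prod_symm' _ (hf.indicator measurableSet_snd_lt_fst.compl)]

lemma setLIntegral_pairDensity_upper {k : ℕ} (hk : 2 ≤ k) :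
    ∫⁻ z in quadrant \ {z | z.2 < z.1}, ENNReal.ofReal (pairDensity k z) =
      ENNReal.ofReal (orderedConst k) := by
  have hinner : ∀ t ∈ Ioi (0 : ℝ), ∫⁻ s in Ioc 0 t, ENNReal.ofReal (pairDensity k (s, t)) =
      ENNReal.ofReal (t * expMoment 1 (t ^ k / k.factorial)) := by
    intro t (ht : 0 < t)
    have hdiag : ∀ s ∈ Ioc 0 t, ENNReal.ofReal (pairDensity k (s, t)) =
        ENNReal.ofReal (expMoment 1 (t ^ k / k.factorial)) := fun s hs => by
      rw [pairDensity, max_eq_right hs.2, expPairMean_self]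
    rw [setLIntegral_congr_fun measurableSet_Ioc hdiag, setLIntegral_const, Real.volume_Ioc,
      sub_zero, mul_comm, ENNReal.ofReal_mul ht.le]
  rw [setLIntegral_quadrant_sdiff (continuous_pairDensity k).measurable.ennreal_ofReal,
    setLIntegral_congr_fun measurableSet_Ioi hinner, lintegral_mul_expMoment_one hk]

lemma two_mul_integral_pairDensity {k : ℕ} (hk : 2 ≤ k) :
    2 * ∫ z in quadrant, pairDensity k z = gam k := by
  have hord := orderedConst_nonneg (k := k) (by omega)
  have hsum : 0 ≤ ∑' j, crossTerm k j := tsum_nonneg fun j => crossTerm_nonneg (by omega) j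
  rw [integral_eq_lintegral_of_nonneg_ae (ae_of_all _ (pairDensity_nonneg k))
    (continuous_pairDensity k).aestronglyMeasurable,
    ← lintegral_inter_add_sdiff _ _ measurableSet_snd_lt_fst,
    setLIntegral_pairDensity_lower hk, setLIntegral_pairDensity_upper hk,
    ← ENNReal.ofReal_add (by positivity) hord, ENNReal.toReal_ofReal (by positivity),
    gam_eq_two_mul_orderedConst hk, add_comm]

end Lower

section Positivity

lemma expMoment_zero_mul_expMoment_zero {σ τ : ℝ} (hσ : 0 < σ) (hτ : 0 < τ) :
    expMoment 0 σ * expMoment 0 τ = expPairMean (σ + τ) τ + expPairMean (σ + τ) σ := by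
  rw [expPairMean_of_ne (by linarith), expPairMean_of_ne (by linarith), expMoment_zero hσ.ne',
    expMoment_zero hτ.ne', expMoment_zero (add_pos hσ hτ).ne', neg_add, Real.exp_add,
    add_sub_cancel_right, add_sub_cancel_left]
  field_simp
  ring

lemma strictAnti_expMoment (i : ℕ) : StrictAnti (expMoment i) := by
  intro σ σ' h
  refine intervalIntegral.integral_lt_integral_of_continuousOn_of_le_of_exists_lt zero_lt_one
    (Continuous.continuousOn (by fun_prop)) (Continuous.continuousOn (by fun_prop))
    (fun ρ hρ => ?_) ⟨1, right_mem_Icc.2 zero_le_one, by simpa using h⟩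
  have := hρ.1.le
  gcongr

lemma strictAnti_expPairMean_left (τ : ℝ) : StrictAnti fun σ => expPairMean σ τ := by
  intro σ σ' h
  refine intervalIntegral.integral_lt_integral_of_continuousOn_of_le_of_exists_lt zero_lt_one
    (Continuous.continuousOn (by fun_prop)) (Continuous.continuousOn (by fun_prop))
    (fun p hp => (strictAnti_expMoment 1).antitone ?_)
    ⟨0, left_mem_Icc.2 zero_le_one, strictAnti_expMoment 1 (by simpa using h)⟩
  have := sub_nonneg.2 hp.2
  gcongr

-- The product is a symmetrised `expPairMean` at the sum of the two arguments, while `pairDensity`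
-- takes their maximum.
lemma expMoment_zero_mul_lt_pairDensity_add_swap (k : ℕ) {z : ℝ × ℝ} (hz : z ∈ quadrant) :
    expMoment 0 (z.1 ^ k / k.factorial) * expMoment 0 (z.2 ^ k / k.factorial) <
      pairDensity k z + pairDensity k z.swap := by
  obtain ⟨hz1 : 0 < z.1, hz2 : 0 < z.2⟩ := hz
  have hlt : max z.1 z.2 ^ k / k.factorial < z.1 ^ k / k.factorial + z.2 ^ k / k.factorial := by
    rw [← add_div]
    gcongr
    rcases max_choice z.1 z.2 with h | h <;> rw [h]
    · exact lt_add_of_pos_right _ (pow_pos hz2 k)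
    · exact lt_add_of_pos_left _ (pow_pos hz1 k)
  rw [expMoment_zero_mul_expMoment_zero (by positivity) (by positivity)]
  refine add_lt_add (strictAnti_expPairMean_left _ hlt) ?_
  simp only [pairDensity, Prod.fst_swap, Prod.snd_swap, max_comm z.2 z.1]
  exact strictAnti_expPairMean_left _ hlt

lemma integrableOn_expMoment_zero {k : ℕ} (hk : 2 ≤ k) :
    IntegrableOn (fun s => expMoment 0 (s ^ k / k.factorial)) (Ioi 0) := by
  refine (integrable_scaleBound k).integrableOn.mono'
    (Continuous.aestronglyMeasurable (by fun_prop))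
    (ae_restrict_of_forall_mem measurableSet_Ioi fun s hs => ?_)
  rw [Real.norm_of_nonneg (expMoment_nonneg _ _)]
  exact le_of_tendsto' (tendsto_recordDensity (by omega) hs) fun n =>
    inv_mul_recordDensity_le_scaleBound hk n hs

lemma restrict_quadrant :
    (volume : Measure (ℝ × ℝ)).restrict quadrant =
      (volume.restrict (Ioi 0)).prod (volume.restrict (Ioi 0)) := by
  rw [quadrant, Measure.prod_restrict, ← Measure.volume_eq_prod]

lemma eta_one_sq {k : ℕ} (hk : 2 ≤ k) :
    eta k 1 ^ 2 = ∫ z in quadrant,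
      expMoment 0 (z.1 ^ k / k.factorial) * expMoment 0 (z.2 ^ k / k.factorial) := by
  rw [restrict_quadrant, integral_prod_mul (fun s => expMoment 0 (s ^ k / k.factorial))
    (fun s => expMoment 0 (s ^ k / k.factorial)), integral_expMoment_zero hk, sq]

lemma integrableOn_pairDensity_swap {k : ℕ} (hk : 2 ≤ k) :
    IntegrableOn (fun z => pairDensity k z.swap) quadrant := by
  have hint := integrableOn_pairDensity hk
  rw [IntegrableOn, restrict_quadrant] at hint ⊢
  exact hint.swap

lemma gam_eq_integral_pairDensity_add_swap {k : ℕ} (hk : 2 ≤ k) :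
    gam k = ∫ z in quadrant, (pairDensity k z + pairDensity k z.swap) := by
  have hswap : ∫ z in quadrant, pairDensity k z.swap = ∫ z in quadrant, pairDensity k z := by
    rw [restrict_quadrant]
    exact integral_prod_swap _
  rw [integral_add (integrableOn_pairDensity hk) (integrableOn_pairDensity_swap hk), hswap,
    ← two_mul_integral_pairDensity hk, two_mul]

lemma setIntegral_lt_setIntegral {α : Type*} [MeasurableSpace α] {μ : Measure α} {s : Set α}
    {f g : α → ℝ} (hs : MeasurableSet s) (hμ : μ s ≠ 0) (hf : IntegrableOn f s μ)
    (hg : IntegrableOn g s μ) (hlt : ∀ x ∈ s, f x < g x) :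
    ∫ x in s, f x ∂μ < ∫ x in s, g x ∂μ := by
  have hsub : s ⊆ Function.support fun x => g x - f x := fun x hx => (sub_pos.2 (hlt x hx)).ne'
  rw [← sub_pos, ← integral_sub hg hf, setIntegral_pos_iff_support_of_nonneg_ae
    (ae_restrict_of_forall_mem hs fun x hx => (sub_pos.2 (hlt x hx)).le) (hg.sub hf),
    inter_eq_self_of_subset_right hsub]
  exact pos_iff_ne_zero.2 hμ

lemma eta_sq_lt_gam {k : ℕ} (hk : 2 ≤ k) : eta k 1 ^ 2 < gam k := by
  have hint := integrableOn_expMoment_zero hk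
  have hprod : IntegrableOn (fun z : ℝ × ℝ =>
      expMoment 0 (z.1 ^ k / k.factorial) * expMoment 0 (z.2 ^ k / k.factorial)) quadrant := by
    rw [IntegrableOn, restrict_quadrant]
    exact hint.mul_prod hint
  rw [eta_one_sq hk, gam_eq_integral_pairDensity_add_swap hk]
  exact setIntegral_lt_setIntegral measurableSet_quadrant
    (by simp [quadrant, Measure.volume_eq_prod]) hprod
    ((integrableOn_pairDensity hk).add (integrableOn_pairDensity_swap hk))
    fun z hz => expMoment_zero_mul_lt_pairDensity_add_swap k hz

lemma gam_pos {k : ℕ} (hk : 2 ≤ k) : 0 < gam k := (sq_nonneg _).trans_lt (eta_sq_lt_gam hk)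

end Positivity

section Asymptotics

lemma scale_div_eq_inv_rpow (k : ℕ) {n : ℕ} (hn : 0 < n) :
    scale k n / n = ((n : ℝ) ^ (1 - 1 / (k : ℝ)))⁻¹ := by
  rw [scale, Real.rpow_sub (by positivity), Real.rpow_one, inv_div]

lemma rpow_one_sub_sq (k n : ℕ) :
    ((n : ℝ) ^ (1 - 1 / (k : ℝ))) ^ 2 = (n : ℝ) ^ (2 - 2 / (k : ℝ)) := by
  rw [← Real.rpow_natCast, ← Real.rpow_mul n.cast_nonneg]
  congr 1
  push_cast
  ring

lemma gam_two_sub_eta_two_sq : gam 2 - eta 2 1 ^ 2 = Real.pi ^ 2 / 2 + 2 - 2 * Real.pi := by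
  have hgam : gam 2 = Real.pi ^ 2 / 2 + 2 := by
    norm_num [gam, lam]
    ring
  have heta : eta 2 1 = √2 * √Real.pi := by
    rw [← Real.Gamma_one_half_eq, Real.sqrt_eq_rpow, eta]
    norm_num
  rw [hgam, heta, mul_pow, Real.sq_sqrt zero_le_two, Real.sq_sqrt Real.pi_pos.le]

lemma isEquivalent_const_mul_of_tendsto_div {α : Type*} {l : Filter α} {u b : α → ℝ} {c : ℝ}
    (hc : c ≠ 0) (h : Tendsto (fun x => u x / b x) l (𝓝 c)) :
    Asymptotics.IsEquivalent l u (fun x => c * b x) := by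
  refine Asymptotics.isEquivalent_of_tendsto_one ?_
  rw [← div_self hc]
  exact (h.div_const c).congr fun x => by rw [Pi.div_apply, div_div, mul_comm]

variable {Ω : Type*} [MeasurableSpace Ω] {P : Measure Ω}
  {T : ℕ → ℕ → Ω → ℝ} (hlaw : ∀ i v, HasLaw (T i v) (expMeasure 1) P)
  (hind : iIndepFun (fun p : ℕ × ℕ => T p.1 p.2) P) {k : ℕ} (hk : 2 ≤ k)

include hlaw hind hk

lemma tendsto_integral_recordCount :
    Tendsto (fun n : ℕ => (∫ ω, recordCount T k n 1 ω ∂P) / (n : ℝ) ^ (1 - 1 / (k : ℝ))) atTop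
      (𝓝 (eta k 1)) := by
  have hlim := tendsto_integral_recordDensity hk
  rw [integral_expMoment_zero hk] at hlim
  refine hlim.congr' ?_
  filter_upwards [eventually_gt_atTop 0] with n hn
  rw [scale_div_eq_inv_rpow k hn, integral_recordCount hlaw hind, inv_mul_eq_div]

lemma tendsto_integral_recordCount_mul_sub_one :
    Tendsto (fun n : ℕ => (∫ ω, recordCount T k n 1 ω * (recordCount T k n 1 ω - 1) ∂P) /
      (n : ℝ) ^ (2 - 2 / (k : ℝ))) atTop (𝓝 (gam k)) := by
  have hlim := (tendsto_integral_recordPairDensity hk).const_mul 2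
  rw [two_mul_integral_pairDensity hk] at hlim
  refine hlim.congr' ?_
  filter_upwards [eventually_gt_atTop 0] with n hn
  rw [scale_div_eq_inv_rpow k hn, integral_recordCount_mul_sub_one hlaw hind (by omega), inv_pow,
    rpow_one_sub_sq, mul_left_comm, inv_mul_eq_div]

-- The first moment is of smaller order, so it does not separate the two second moments.
lemma tendsto_integral_recordCount_sq :
    Tendsto (fun n : ℕ => (∫ ω, recordCount T k n 1 ω ^ 2 ∂P) / (n : ℝ) ^ (2 - 2 / (k : ℝ)))
      atTop (𝓝 (gam k)) := by
  have := hind.isProbabilityMeasure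
  have hexponent : 0 < 1 - 1 / (k : ℝ) :=
    sub_pos.2 ((div_lt_one (by positivity)).2 (by exact_mod_cast hk))
  have hinv : Tendsto (fun n : ℕ => ((n : ℝ) ^ (1 - 1 / (k : ℝ)))⁻¹) atTop (𝓝 0) :=
    ((tendsto_rpow_atTop hexponent).comp tendsto_natCast_atTop_atTop).inv_tendsto_atTop
  have hlim := (tendsto_integral_recordCount_mul_sub_one hlaw hind hk).add
    ((tendsto_integral_recordCount hlaw hind hk).mul hinv)
  rw [mul_zero, add_zero] at hlim
  refine hlim.congr fun n => ?_
  have hmemLp := memLp_recordCount (fun i v => (hlaw i v).aemeasurable) k n 1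
  simp only [mul_sub_one, ← sq]
  rw [integral_sub hmemLp.integrable_sq (hmemLp.integrable one_le_two), ← rpow_one_sub_sq]
  ring

lemma tendsto_variance_recordCount :
    Tendsto (fun n : ℕ => variance (recordCount T k n 1) P / (n : ℝ) ^ (2 - 2 / (k : ℝ)))
      atTop (𝓝 (gam k - eta k 1 ^ 2)) := by
  have := hind.isProbabilityMeasure
  refine ((tendsto_integral_recordCount_sq hlaw hind hk).sub
    ((tendsto_integral_recordCount hlaw hind hk).pow 2)).congr fun n => ?_
  rw [variance_eq_sub (memLp_recordCount (fun i v => (hlaw i v).aemeasurable) k n 1), div_pow,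
    rpow_one_sub_sq, ← sub_div]
  rfl

end Asymptotics

end KCut

theorem mainTheorem3 {Ω : Type*} [MeasurableSpace Ω] (P : Measure Ω) [IsProbabilityMeasure P]
    (T : ℕ → ℕ → Ω → ℝ)
    (hlaw : ∀ i v, HasLaw (T i v) (expMeasure 1) P)
    (hindep : iIndepFun (fun p : ℕ × ℕ => T p.1 p.2) P)
    (k : ℕ) (hk : 2 ≤ k) :
    Asymptotics.IsEquivalent Filter.atTop
      (fun n : ℕ => ∫ ω, KCut.recordCount T k n 1 ω * (KCut.recordCount T k n 1 ω - 1) ∂P)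
      (fun n : ℕ => ∫ ω, KCut.recordCount T k n 1 ω ^ 2 ∂P) ∧
    Asymptotics.IsEquivalent Filter.atTop
      (fun n : ℕ => ∫ ω, KCut.recordCount T k n 1 ω ^ 2 ∂P)
      (fun n : ℕ => KCut.gam k * (n : ℝ) ^ (2 - 2 / (k : ℝ))) ∧
    Asymptotics.IsEquivalent Filter.atTop
      (fun n : ℕ => variance (KCut.recordCount T k n 1) P)
      (fun n : ℕ => (KCut.gam k - KCut.eta k 1 ^ 2) * (n : ℝ) ^ (2 - 2 / (k : ℝ))) ∧
    (k = 2 →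
      Asymptotics.IsEquivalent Filter.atTop
        (fun n : ℕ => variance (KCut.recordCount T k n 1) P)
        (fun n : ℕ => (Real.pi ^ 2 / 2 + 2 - 2 * Real.pi) * (n : ℝ))) := by
  have hpairs := KCut.isEquivalent_const_mul_of_tendsto_div (KCut.gam_pos hk).ne'
    (KCut.tendsto_integral_recordCount_mul_sub_one hlaw hindep hk)
  have hsquares := KCut.isEquivalent_const_mul_of_tendsto_div (KCut.gam_pos hk).ne'
    (KCut.tendsto_integral_recordCount_sq hlaw hindep hk)
  have hvariance := KCut.isEquivalent_const_mul_of_tendsto_div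
    (sub_pos.2 (KCut.eta_sq_lt_gam hk)).ne' (KCut.tendsto_variance_recordCount hlaw hindep hk)
  refine ⟨hpairs.trans hsquares.symm, hsquares, hvariance, ?_⟩
  rintro rfl
  convert! hvariance using 2 with n
  rw [KCut.gam_two_sub_eta_two_sq]
  norm_num
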